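/- Let $n\ge 5$, $m\ge 2$ and $k\ge n+m$ be integers, and consider $k$ qubits $q_1,\dots,q_k$ arranged on a line. Let $C=\{c_1,\dots,c_n\}$ and $\tau=\{t_1,\dots,t_m\}$ be disjoint sets of $n$ control qubits and $m$ target qubits, placed at arbitrary positions among $q_1,\dots,q_k$. The multi-controlled multi-target $X$ gate is the $k$-qubit unitary $\prod_{j=1}^m C^{C}X_{t_j}$, where $C^{C}X_{t}$ applies the Pauli matrix $X$ to qubit $t$ on the computational basis states in which all qubits of $C$ are $1$ and fixes all other basis states; it acts as the identity on the $k-n-m$ remaining qubits. A circuit over $\{\mathrm{CNOT},H,T,T^\dagger\}$, with $T=\mathrm{diag}(1,e^{i\pi/4})$, is a finite sequence of time slots, each consisting of gates acting on pairwise disjoint sets of qubits. It is LNN (linear nearest neighbor) if each of its CNOT gates acts on two neighboring qubits $q_l,q_{l+1}$ (in either direction). The cost of a gate type is the number of gates of that type, and its depth is the number of time slots that contain at least one gate of that type; $T$ and $T^\dagger$ both count as $T$ gates. Then for every such choice of $C$ and $\tau$ there is an LNN circuit on the qubits $q_1,\dots,q_k$ alone (no ancilla qubit is added, and the remaining qubits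 may be in any state) that consists of $\mathrm{CNOT},H,T,T^\dagger$ gates only, implements the multi-controlled multi-target $X$ gate exactly, and satisfies all of the following bounds: - CNOT: cost at most $12k+14n-2m-34$ and depth at most $12k+5n-2m+1$; - $T$: cost at most $16n-16$ and depth at most $4n+4$; - $H$: cost at most $8n+2m+2$ and depth at most $4n+2m+1$. -/

import Mathlib

noncomputable section

namespace LNN

/-- Operators on `k` qubits, as matrices in the computational basis `Fin k → Fin 2`. -/
abbrev Op (k : ℕ) : Type := Matrix (Fin k → Fin 2) (Fin k → Fin 2) ℂ

/-- The Hadamard matrix. -/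
def hadamard : Matrix (Fin 2) (Fin 2) ℂ :=
  ((Real.sqrt 2 : ℝ) : ℂ)⁻¹ • !![1, 1; 1, -1]

/-- The phase gate `T = diag (1, exp (i π / 4))`. -/
def tMatrix : Matrix (Fin 2) (Fin 2) ℂ :=
  !![1, 0; 0, Complex.exp (Complex.I * (Real.pi / 4))]

/-- The Pauli matrix `X`. -/
def pauliX : Matrix (Fin 2) (Fin 2) ℂ := !![0, 1; 1, 0]

/-- The single-qubit operator `U` applied to qubit `q`, identity on all other qubits. -/
def onQubit {k : ℕ} (U : Matrix (Fin 2) (Fin 2) ℂ) (q : Fin k) : Op k :=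
  fun x y => if ∀ j, j ≠ q → x j = y j then U (x q) (y q) else 0

/-- The operator `U` applied to qubit `t`, controlled by the qubits in `C` (with `t ∉ C`):
basis states in which all qubits of `C` are `1` get `U` on qubit `t`, all others are fixed. -/
def controlled {k : ℕ} (U : Matrix (Fin 2) (Fin 2) ℂ) (C : Finset (Fin k)) (t : Fin k) : Op k :=
  fun x y => if ∀ c ∈ C, y c = 1 then onQubit U t x y else (1 : Op k) x y

/-- The multi-controlled multi-target `X` gate with controls `c 0, …, c (n - 1)` and targets
`t 0, …, t (m - 1)`: the product over the targets of the multi-controlled `X` gates. -/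
def mcmtX {n m k : ℕ} (c : Fin n ↪ Fin k) (t : Fin m ↪ Fin k) : Op k :=
  (List.ofFn fun j : Fin m => controlled pauliX (Finset.univ.map c) (t j)).prod

/-- The elementary gates on `k` qubits: `H`, `T`, `T†` and `CNOT`. -/
inductive Gate (k : ℕ) : Type
  | h (q : Fin k) : Gate k
  | t (q : Fin k) : Gate k
  | tdg (q : Fin k) : Gate k
  | cnot (ctl tgt : Fin k) : Gate k

/-- The gate types whose cost and depth are counted. -/
inductive GateType : Type
  | cnot : GateType
  | t : GateType
  | h : GateType
  deriving DecidableEq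

namespace Gate

variable {k : ℕ}

/-- The type of a gate; `T` and `T†` both count as `T` gates. -/
def type : Gate k → GateType
  | h _ => GateType.h
  | t _ => GateType.t
  | tdg _ => GateType.t
  | cnot _ _ => GateType.cnot

/-- The qubits on which a gate acts. -/
def support : Gate k → Finset (Fin k)
  | h q => {q}
  | t q => {q}
  | tdg q => {q}
  | cnot a b => {a, b}

/-- The operator of a gate. -/
def op : Gate k → Op k
  | h q => onQubit hadamard q
  | t q => onQubit tMatrix q
  | tdg q => onQubit tMatrix.conjTranspose q
  | cnot a b => controlled pauliX {a} b

/-- Linear-nearest-neighbor condition: a `CNOT` acts on two consecutive qubits of the line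
`0, 1, …, k - 1`, in either direction. -/
def IsLNN : Gate k → Prop
  | cnot a b => (a : ℕ) + 1 = b ∨ (b : ℕ) + 1 = a
  | _ => True

end Gate

/-- A circuit on `k` qubits: the list of its time slots, in the order of execution, each being
the list of the gates executed in that slot. -/
abbrev Circuit (k : ℕ) : Type := List (List (Gate k))

namespace Circuit

variable {k : ℕ}

/-- The gates of each time slot act on pairwise disjoint sets of qubits, so that they can be
executed in parallel. -/
def IsValid (A : Circuit k) : Prop :=
  ∀ slot ∈ A, slot.Pairwise fun g g' => Disjoint g.support g'.support

/-- Every gate of the circuit obeys the linear-nearest-neighbor condition. -/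
def IsLNN (A : Circuit k) : Prop :=
  ∀ slot ∈ A, ∀ g ∈ slot, g.IsLNN

/-- The operator of a circuit: the product of its gates, the first one executed being the
rightmost factor. -/
def op (A : Circuit k) : Op k :=
  (A.flatten.map Gate.op).reverse.prod

/-- The cost of a gate type: the number of gates of that type. -/
def cost (A : Circuit k) (τ : GateType) : ℕ :=
  A.flatten.countP fun g => g.type = τ

/-- The depth of a gate type: the number of time slots with at least one gate of that type. -/
def depth (A : Circuit k) (τ : GateType) : ℕ :=
  A.countP fun slot => ∃ g ∈ slot, g.type = τ

end Circuit

end LNN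

end

/-!
The multi-controlled multi-target gate is the permutation `cGate E F` of the basis states that flips
the bits of `F` when all bits of `E` are `1` (`mcmtX_eq_cGate`).

*Reduction to one target.* Conjugation by a nearest-neighbor `CNOT` circuit changes `E` and `F`. A
ladder of `CNOT` gates removes the leftmost of two consecutive targets (`Reduces.erase`), and two
`CNOT` gates exchange an adjacent non-control and non-target (`Reduces.swap`). With at most
`2k - m - 1` `CNOT` gates all targets are merged into the last qubit, and the qubit of the first
target, being free after the ladder, is moved to the front of the line (`exists_reduces`). There it
serves as a dirty qubit `d`, so that no ancilla is needed.

*One target, one dirty qubit.* Split the controls by the parity of their positions into `A`, which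
contains the last control `z`, and `B`; no two controls in one part are neighbors. A chain of gates
along the line, from `d` to the wire before an end wire, consists of `CNOT` gates on wires that are
no control of the part at hand, and of relative-phase Toffoli gates from a wire and the control next
to it onto the right neighbor of the control (`blockK_conj`). Conjugating a `CNOT` onto the end wire
by the chain gives a toggle of the end wire, with all phases cancelled (`conj_tog`). Its condition
is affine in `d`, and the coefficient of `d` is the product of the controls in the chain, whatever
the values of the other wires are (`AffineAt`, `exists_chain`).

For the part `B` and the end wire `y`, the target, this is an operator that toggles `y`. For the part
`A` and the end wire `z`, Hadamard gates on `d` and `z` exchange the roles of the two ends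
(`hadamard_conj_tog`), which gives an operator toggling `d` under the control of `A`, up to signs
that depend neither on `d` nor on `y`. In the commutator of the two operators everything cancels
except for the flip of `y` controlled by `A ∪ B` (`commutator_eq`, `realizes_cGate_last`).

*Depth.* Each Toffoli block is `K⁻¹ · CNOT · K`, where `K` does not involve the source of the block.
Hence in a chain the factors `K` of all blocks are executed in parallel in four common slots, and
only the remaining steps are sequential. All slots of the circuit hold gates of one type only, so
that the depths are read off from the list of the types of the slots (`Realizes`).
-/

noncomputable section

namespace LNN

variable {k : ℕ}

/-! ### Monomial operators -/

/-- The operator sending the basis state `y` to `ω y` times the basis state `f y`. -/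
def monoOp (f : (Fin k → Fin 2) → Fin k → Fin 2) (ω : (Fin k → Fin 2) → ℂ) : Op k :=
  fun x y => if x = f y then ω y else 0

/-- The operator sending the basis state `y` to `f y`; a permutation matrix if `f` is bijective. -/
abbrev permOp (f : (Fin k → Fin 2) → Fin k → Fin 2) : Op k := monoOp f fun _ => 1

theorem mul_monoOp_apply (M : Op k) (f : (Fin k → Fin 2) → Fin k → Fin 2)
    (ω : (Fin k → Fin 2) → ℂ) (x y : Fin k → Fin 2) :
    (M * monoOp f ω) x y = M x (f y) * ω y := by
  simp [Matrix.mul_apply, monoOp]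

theorem monoOp_mul_apply {f g : (Fin k → Fin 2) → Fin k → Fin 2} (hfg : ∀ x, f (g x) = x)
    (hgf : ∀ x, g (f x) = x) (ω : (Fin k → Fin 2) → ℂ) (M : Op k)
    (x y : Fin k → Fin 2) :
    (monoOp f ω * M) x y = ω (g x) * M (g x) y := by
  have h : ∀ z, x = f z ↔ g x = z := fun z =>
    ⟨fun h => by rw [h, hgf], fun h => by rw [← h, hfg]⟩
  simp [Matrix.mul_apply, monoOp, h]

theorem monoOp_mul_monoOp (f g : (Fin k → Fin 2) → Fin k → Fin 2)
    (ω η : (Fin k → Fin 2) → ℂ) :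
    monoOp f ω * monoOp g η = monoOp (f ∘ g) (fun y => ω (g y) * η y) := by
  ext x y
  simp [mul_monoOp_apply, monoOp]

theorem permOp_mul_permOp (f g : (Fin k → Fin 2) → Fin k → Fin 2) :
    permOp f * permOp g = permOp (f ∘ g) := by
  simp [permOp, monoOp_mul_monoOp]

theorem monoOp_id : monoOp id (fun _ => 1) = (1 : Op k) := by
  ext x y
  simp [monoOp, Matrix.one_apply]

theorem conjTranspose_monoOp {f g : (Fin k → Fin 2) → Fin k → Fin 2} (hfg : ∀ x, f (g x) = x)
    (hgf : ∀ x, g (f x) = x) (ω : (Fin k → Fin 2) → ℂ) :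
    (monoOp f ω).conjTranspose = monoOp g (fun x => star (ω (g x))) := by
  ext x y
  have h : y = f x ↔ x = g y := ⟨fun h => by rw [h, hgf], fun h => by rw [h, hfg]⟩
  by_cases hx : x = g y
  · rw [Matrix.conjTranspose_apply, monoOp, monoOp, if_pos (h.2 hx), if_pos hx, hx]
  · simp only [Matrix.conjTranspose_apply, monoOp, if_neg (fun h' => hx (h.1 h')), if_neg hx,
      star_zero]

/-! ### The elementary gates -/

theorem fin_two_cases (a : Fin 2) : a = 0 ∨ a = 1 := by omega

theorem fin_two_add_self (a : Fin 2) : a + a = 0 := by revert a; decide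

theorem fin_two_add_add_self (a b : Fin 2) : a + b + b = a := by revert a b; decide

theorem forall_ne_eq_iff_update {x y : Fin k → Fin 2} {q : Fin k} :
    (∀ j, j ≠ q → x j = y j) ↔ x = Function.update y q (x q) := by
  rw [Function.eq_update_iff]
  simp

/-- Action of the `CNOT` with control `a` and target `b` on configurations. -/
def cx (a b : Fin k) (x : Fin k → Fin 2) : Fin k → Fin 2 := Function.update x b (x b + x a)

theorem cx_cx {a b : Fin k} (hab : a ≠ b) (x : Fin k → Fin 2) : cx a b (cx a b x) = x := by
  ext j
  by_cases hj : j = b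
  · subst hj; simp [cx, hab, fin_two_add_add_self]
  · simp [cx, hj]

theorem cx_apply_self (a b : Fin k) (x : Fin k → Fin 2) : cx a b x b = x b + x a := by
  simp [cx]

theorem cx_apply_of_ne {a b j : Fin k} (h : j ≠ b) (x : Fin k → Fin 2) : cx a b x j = x j := by
  simp [cx, h]

/-- Action on configurations of the flip of all bits of `F` controlled by the bits of `E`. -/
def cflip (E F : Finset (Fin k)) (x : Fin k → Fin 2) : Fin k → Fin 2 :=
  fun j => if j ∈ F ∧ ∀ e ∈ E, x e = 1 then x j + 1 else x j

/-- The gate flipping all qubits of `F` on the basis states in which all qubits of `E` are `1`. -/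
def cGate (E F : Finset (Fin k)) : Op k := permOp (cflip E F)

theorem controlled_pauliX (C : Finset (Fin k)) (t : Fin k) :
    controlled pauliX C t = cGate C {t} := by
  have hX : ∀ a b : Fin 2, pauliX a b = if a = b + 1 then 1 else 0 := by
    intro a b; fin_cases a <;> fin_cases b <;> simp [pauliX]
  ext x y
  simp only [controlled, cGate, permOp, monoOp]
  split_ifs with h1 h2 h2
  · subst h2
    simp only [onQubit, hX]
    rw [if_pos, if_pos] <;> simp +contextual [cflip, h1]
  · simp only [onQubit, hX]
    split_ifs with h3 h4
    · exact (h2 (funext fun j => by by_cases hj : j = t <;> simp_all [cflip])).elim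
    · rfl
    · rfl
  · have : cflip C {t} y = y := by ext j; simp [cflip, h1]
    rw [h2, this]
    exact Matrix.one_apply_eq y
  · have : cflip C {t} y = y := by ext j; simp [cflip, h1]
    rw [this] at h2
    exact Matrix.one_apply_ne h2

theorem cflip_singleton (a b : Fin k) : cflip {a} {b} = cx a b := by
  ext x j
  by_cases hj : j = b
  · subst hj
    rcases fin_two_cases (x a) with h | h <;> simp [cflip, cx, h]
  · simp [cflip, cx, hj]

theorem cnot_op (a b : Fin k) : (Gate.cnot a b).op = permOp (cx a b) := by
  rw [Gate.op, controlled_pauliX, cGate, cflip_singleton]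

theorem conjTranspose_onQubit (U : Matrix (Fin 2) (Fin 2) ℂ) (q : Fin k) :
    (onQubit U q).conjTranspose = onQubit U.conjTranspose q := by
  ext x y
  have h : (∀ j, j ≠ q → y j = x j) ↔ (∀ j, j ≠ q → x j = y j) :=
    forall₂_congr fun j _ => eq_comm
  by_cases hx : ∀ j, j ≠ q → x j = y j
  · simp only [Matrix.conjTranspose_apply, onQubit, h, if_pos hx]
  · simp only [Matrix.conjTranspose_apply, onQubit, h, if_neg hx, star_zero]

theorem onQubit_mul_onQubit (U V : Matrix (Fin 2) (Fin 2) ℂ) (q : Fin k) :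
    onQubit U q * onQubit V q = onQubit (U * V) q := by
  ext x y
  rw [Matrix.mul_apply]
  by_cases hxy : ∀ j, j ≠ q → x j = y j
  · have key : ∀ z, onQubit U q x z * onQubit V q z y =
        ∑ b : Fin 2, if z = Function.update y q b then U (x q) b * V b (y q) else 0 := by
      intro z
      by_cases hz : ∀ j, j ≠ q → z j = y j
      · have hx : ∀ j, j ≠ q → x j = z j := fun j hj => (hxy j hj).trans (hz j hj).symm
        rw [Finset.sum_eq_single (z q)]
        · simp only [onQubit, if_pos hz, if_pos hx, if_pos (forall_ne_eq_iff_update.1 hz)]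
        · intro b _ hb
          rw [if_neg]
          intro h
          exact hb (by rw [h]; simp)
        · simp
      · rw [Finset.sum_eq_zero, onQubit, onQubit, if_neg hz, mul_zero]
        intro b _
        rw [if_neg]
        rintro rfl
        exact hz fun j hj => by simp [hj]
    simp_rw [key]
    rw [Finset.sum_comm]
    simp [onQubit, if_pos hxy, Matrix.mul_apply]
  · rw [onQubit, if_neg hxy, Finset.sum_eq_zero]
    intro z _
    by_contra h
    have h1 : ∀ j, j ≠ q → x j = z j := by
      by_contra h1; exact h (by simp [onQubit, if_neg h1])
    have h2 : ∀ j, j ≠ q → z j = y j := by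
      by_contra h2; exact h (by simp [onQubit, if_neg h2])
    exact hxy fun j hj => (h1 j hj).trans (h2 j hj)

theorem onQubit_one (q : Fin k) : onQubit 1 q = (1 : Op k) := by
  ext x y
  by_cases h : x = y
  · subst h; simp [onQubit]
  · rw [Matrix.one_apply_ne h, onQubit]
    split_ifs with h1
    · rw [Matrix.one_apply_ne]
      intro h2
      exact h (funext fun j => by by_cases hj : j = q; exacts [hj ▸ h2, h1 j hj])
    · rfl

theorem hadamard_conjTranspose : hadamard.conjTranspose = hadamard := by
  ext i j
  fin_cases i <;> fin_cases j <;> simp [hadamard]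

theorem hadamard_mul_hadamard : hadamard * hadamard = 1 := by
  have h2 : ((Real.sqrt 2 : ℝ) : ℂ) * ((Real.sqrt 2 : ℝ) : ℂ) = 2 := by
    rw [← Complex.ofReal_mul, Real.mul_self_sqrt (by norm_num)]; norm_num
  have h0 : ((Real.sqrt 2 : ℝ) : ℂ) ≠ 0 := by
    intro h; rw [h] at h2; norm_num at h2
  have h3 : ((Real.sqrt 2 : ℝ) : ℂ)⁻¹ * ((Real.sqrt 2 : ℝ) : ℂ)⁻¹ = 1 / 2 := by
    rw [← mul_inv, h2]; norm_num
  ext i j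
  fin_cases i <;> fin_cases j <;> simp [hadamard, Matrix.mul_apply, Fin.sum_univ_two, h3] <;>
    norm_num

theorem hadamard_apply (a b : Fin 2) :
    hadamard a b = ((Real.sqrt 2 : ℝ) : ℂ)⁻¹ * if a = 1 ∧ b = 1 then -1 else 1 := by
  fin_cases a <;> fin_cases b <;> simp [hadamard]

theorem hadamard_onQubit_conjTranspose (q : Fin k) :
    (onQubit hadamard q).conjTranspose = onQubit hadamard q := by
  rw [conjTranspose_onQubit, hadamard_conjTranspose]

theorem hadamard_onQubit_mul_self (q : Fin k) :
    onQubit hadamard q * onQubit hadamard q = 1 := by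
  rw [onQubit_mul_onQubit, hadamard_mul_hadamard, onQubit_one]

/-- The phase `exp (i π / 4)`. -/
def ζ : ℂ := Complex.exp (Complex.I * (Real.pi / 4))

theorem ζ_mul_ζ : ζ * ζ = Complex.I := by
  rw [ζ, ← Complex.exp_add]
  have h : Complex.I * (Real.pi / 4) + Complex.I * (Real.pi / 4) =
      (Real.pi / 2 * Complex.I : ℂ) := by ring
  rw [h, Complex.exp_pi_div_two_mul_I]

theorem ζ_mul_star : ζ * star ζ = 1 := by
  rw [Complex.star_def, Complex.mul_conj, Complex.normSq_eq_norm_sq, ζ]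
  have h : Complex.I * (Real.pi / 4) = ((Real.pi / 4 : ℝ) : ℂ) * Complex.I := by
    push_cast; ring
  rw [h, Complex.norm_exp_ofReal_mul_I]
  simp

theorem t_op (q : Fin k) :
    (Gate.t q).op = monoOp id fun x => if x q = 1 then ζ else 1 := by
  ext x y
  by_cases h : x = y
  · subst h
    rcases fin_two_cases (x q) with h | h <;> simp [Gate.op, onQubit, monoOp, h, tMatrix, ζ]
  · simp only [Gate.op, onQubit, monoOp, id, if_neg h]
    split_ifs with h1
    · have h2 : x q ≠ y q := fun h2 =>
        h (funext fun j => by by_cases hj : j = q; exacts [hj ▸ h2, h1 j hj])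
      rcases fin_two_cases (x q) with h3 | h3 <;> rcases fin_two_cases (y q) with h4 | h4 <;>
        simp_all [tMatrix]
    · rfl

theorem tdg_op (q : Fin k) :
    (Gate.tdg q).op = monoOp id fun x => if x q = 1 then star ζ else 1 := by
  have h : (Gate.tdg q).op = (Gate.t q).op.conjTranspose := by
    simp only [Gate.op, conjTranspose_onQubit]
  rw [h, t_op, conjTranspose_monoOp (f := id) (g := id) (fun _ => rfl) (fun _ => rfl)]
  congr 1
  ext x
  simp [apply_ite (starRingEnd ℂ)]

/-- The inverse of a gate. -/
def Gate.inv : Gate k → Gate k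
  | .h q => .h q
  | .t q => .tdg q
  | .tdg q => .t q
  | .cnot a b => .cnot a b

theorem Gate.inv_type (g : Gate k) : g.inv.type = g.type := by cases g <;> rfl

theorem Gate.inv_support (g : Gate k) : g.inv.support = g.support := by cases g <;> rfl

theorem Gate.inv_isLNN {g : Gate k} (h : g.IsLNN) : g.inv.IsLNN := by
  cases g <;> exact h

theorem Gate.ne_of_isLNN {a b : Fin k} (h : (Gate.cnot a b).IsLNN) : a ≠ b := by
  rintro rfl
  simp only [Gate.IsLNN] at h
  omega

theorem Gate.inv_op {g : Gate k} (h : g.IsLNN) : g.inv.op = g.op.conjTranspose := by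
  cases g with
  | h q => exact (hadamard_onQubit_conjTranspose q).symm
  | t q => simp only [Gate.inv, Gate.op, conjTranspose_onQubit]
  | tdg q => simp only [Gate.inv, Gate.op, conjTranspose_onQubit, Matrix.conjTranspose_conjTranspose]
  | cnot a b =>
    have hab := Gate.ne_of_isLNN h
    rw [Gate.inv, cnot_op, conjTranspose_monoOp (g := cx a b) (cx_cx hab) (cx_cx hab)]
    simp

theorem monoOp_unitary {f g : (Fin k → Fin 2) → Fin k → Fin 2} (hfg : ∀ x, f (g x) = x)
    (hgf : ∀ x, g (f x) = x) {ω : (Fin k → Fin 2) → ℂ} (hω : ∀ x, ω x * star (ω x) = 1) :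
    monoOp f ω * (monoOp f ω).conjTranspose = 1 := by
  rw [conjTranspose_monoOp hfg hgf, monoOp_mul_monoOp, ← monoOp_id]
  congr 1
  · ext x; simp [hfg]
  · ext x; exact hω _

theorem Gate.op_unitary {g : Gate k} (h : g.IsLNN) : g.op * g.op.conjTranspose = 1 := by
  cases g with
  | h q =>
    rw [Gate.op, hadamard_onQubit_conjTranspose, hadamard_onQubit_mul_self]
  | t q =>
    rw [t_op]
    refine monoOp_unitary (g := id) (fun _ => rfl) (fun _ => rfl) fun x => ?_
    split_ifs
    · exact ζ_mul_star
    · simp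
  | tdg q =>
    rw [tdg_op]
    refine monoOp_unitary (g := id) (fun _ => rfl) (fun _ => rfl) fun x => ?_
    split_ifs
    · rw [star_star, mul_comm]; exact ζ_mul_star
    · simp
  | cnot a b =>
    have hab := Gate.ne_of_isLNN h
    rw [cnot_op]
    exact monoOp_unitary (cx_cx hab) (cx_cx hab) fun x => by simp

/-! ### Operators supported on a set of qubits -/

/-- `M` acts on the qubits of `S` only: its entries vanish between configurations that differ
off `S`, and otherwise do not depend on the values off `S`. -/
def SupportedOn (S : Finset (Fin k)) (M : Op k) : Prop :=
  (∀ x y, M x y ≠ 0 → ∀ j ∉ S, x j = y j) ∧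
  ∀ x y x' y', (∀ j ∉ S, x j = y j) → (∀ j ∉ S, x' j = y' j) →
    (∀ j ∈ S, x j = x' j) → (∀ j ∈ S, y j = y' j) → M x y = M x' y'

/-- For disjoint supports, the product has a single intermediate configuration. -/
theorem SupportedOn.mul_apply {S T : Finset (Fin k)} {M N : Op k} (hM : SupportedOn S M)
    (hN : SupportedOn T N) (hST : Disjoint S T) (x y : Fin k → Fin 2) :
    (M * N) x y = M x (fun j => if j ∈ S then y j else x j) *
      N (fun j => if j ∈ S then y j else x j) y := by
  rw [Matrix.mul_apply, Finset.sum_eq_single]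
  · intro z _ hz
    by_contra h
    refine hz (funext fun j => ?_)
    split_ifs with hj
    · exact hN.1 z y (right_ne_zero_of_mul h) j (Finset.disjoint_left.1 hST hj)
    · exact (hM.1 x z (left_ne_zero_of_mul h) j hj).symm
  · simp

/-- Operators supported on disjoint sets of qubits commute. -/
theorem SupportedOn.commute {S T : Finset (Fin k)} {M N : Op k} (hM : SupportedOn S M)
    (hN : SupportedOn T N) (hST : Disjoint S T) : M * N = N * M := by
  ext x y
  rw [hM.mul_apply hN hST, hN.mul_apply hM hST.symm, mul_comm]
  by_cases hxy : ∀ j, j ∉ S → j ∉ T → x j = y j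
  · congr 1
    · refine hN.2 _ _ _ _ (fun j hj => ?_) (fun j hj => ?_) (fun j hj => ?_) fun j hj => ?_
      · by_cases hS : j ∈ S
        · simp [hS]
        · simp [hS, hxy j hS hj]
      · simp [hj]
      · simp [Finset.disjoint_right.1 hST hj]
      · simp [hj]
    · refine hM.2 _ _ _ _ (fun j hj => ?_) (fun j hj => ?_) (fun j hj => ?_) fun j hj => ?_
      · simp [hj]
      · by_cases hT : j ∈ T
        · simp [hT]
        · simp [hT, hxy j hj hT]
      · simp [Finset.disjoint_left.1 hST hj]
      · simp [hj]
  · push Not at hxy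
    obtain ⟨j, hS, hT, hj⟩ := hxy
    rw [mul_eq_zero_of_left, mul_eq_zero_of_right]
    · by_contra h
      exact hj (by simpa [hS, hT] using hM.1 _ _ h j hS)
    · by_contra h
      exact hj (by simpa [hS, hT] using hN.1 _ _ h j hT)

theorem supportedOn_onQubit (U : Matrix (Fin 2) (Fin 2) ℂ) (q : Fin k) :
    SupportedOn {q} (onQubit U q) := by
  constructor
  · intro x y h j hj
    have hj : j ≠ q := by simpa using hj
    by_contra h1
    exact h (by rw [onQubit, if_neg]; exact fun h2 => h1 (h2 j hj))
  · intro x y x' y' h1 h2 h3 h4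
    simp only [Finset.mem_singleton] at h1 h2 h3 h4
    rw [onQubit, onQubit, if_pos h1, if_pos h2, h3 q rfl, h4 q rfl]

theorem Gate.supportedOn_op (g : Gate k) : SupportedOn g.support g.op := by
  cases g with
  | h q => exact supportedOn_onQubit _ q
  | t q => exact supportedOn_onQubit _ q
  | tdg q => exact supportedOn_onQubit _ q
  | cnot a b =>
    rw [cnot_op]
    constructor
    · intro x y h j hj
      simp only [monoOp, ne_eq, ite_eq_right_iff, Classical.not_imp] at h
      simp only [Gate.support, Finset.mem_insert, Finset.mem_singleton, not_or] at hj
      rw [h.1, cx_apply_of_ne hj.2]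
    · intro x y x' y' h1 h2 h3 h4
      have key : ∀ u w : Fin k → Fin 2, (∀ j ∉ (Gate.cnot a b).support, u j = w j) →
          (u = cx a b w ↔ ∀ j ∈ (Gate.cnot a b).support, u j = cx a b w j) := by
        intro u w h
        refine ⟨fun h' j _ => by rw [h'], fun h' => funext fun j => ?_⟩
        by_cases hj : j ∈ (Gate.cnot a b).support
        · exact h' j hj
        · rw [cx_apply_of_ne (fun hb => hj (by simp [Gate.support, hb])), h j hj]
      have ha : a ∈ (Gate.cnot a b).support := by simp [Gate.support]
      have hb : b ∈ (Gate.cnot a b).support := by simp [Gate.support]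
      have : x = cx a b y ↔ x' = cx a b y' := by
        rw [key x y h1, key x' y' h2]
        refine forall₂_congr fun j hj => ?_
        rw [h3 j hj]
        by_cases hjb : j = b
        · subst hjb; rw [cx_apply_self, cx_apply_self, h4 _ ha, h4 _ hj]
        · rw [cx_apply_of_ne hjb, cx_apply_of_ne hjb, h4 j hj]
      simp only [monoOp, this]

/-! ### Circuits with slots of prescribed gate types -/

namespace Circuit

theorem op_append (A B : Circuit k) : op (A ++ B) = op B * op A := by
  simp [op]

/-- The inverse circuit: the inverse gates in reverse order. -/
def inv (A : Circuit k) : Circuit k := (A.map fun s => (s.map Gate.inv).reverse).reverse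

theorem inv_flatten (A : Circuit k) : A.inv.flatten = (A.flatten.map Gate.inv).reverse := by
  rw [inv, List.map_flatten, List.reverse_flatten, List.map_map]
  rfl

theorem inv_op {A : Circuit k} (hA : A.IsLNN) : A.inv.op = A.op.conjTranspose := by
  rw [op, op, inv_flatten, Matrix.conjTranspose_list_prod, List.map_reverse, List.reverse_reverse,
    List.map_reverse, List.reverse_reverse, List.map_map, List.map_map]
  congr 1
  refine List.map_congr_left fun g hg => ?_
  obtain ⟨s, hs, hg⟩ := List.mem_flatten.1 hg
  exact Gate.inv_op (hA s hs g hg)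

theorem op_unitary {A : Circuit k} (hA : A.IsLNN) : A.op * A.op.conjTranspose = 1 := by
  have h : ∀ l : List (Gate k), (∀ g ∈ l, g.IsLNN) →
      (l.map Gate.op).reverse.prod * (l.map Gate.op).reverse.prod.conjTranspose = 1 := by
    intro l
    induction l with
    | nil => simp
    | cons g l ih =>
      intro hl
      rw [List.forall_mem_cons] at hl
      rw [List.map_cons, List.reverse_cons, List.prod_append, List.prod_singleton,
        Matrix.conjTranspose_mul]
      calc _ = (l.map Gate.op).reverse.prod * (g.op * g.op.conjTranspose) *
            (l.map Gate.op).reverse.prod.conjTranspose := by noncomm_ring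
        _ = 1 := by rw [Gate.op_unitary hl.1, mul_one, ih hl.2]
  refine h _ fun g hg => ?_
  obtain ⟨s, hs, hg⟩ := List.mem_flatten.1 hg
  exact hA s hs g hg

theorem op_commute {A B : Circuit k}
    (h : ∀ s ∈ A, ∀ g ∈ s, ∀ s' ∈ B, ∀ g' ∈ s', Disjoint g.support g'.support) :
    Commute A.op B.op := by
  refine Commute.list_prod_left _ _ fun M hM => Commute.list_prod_right _ _ fun N hN => ?_
  simp only [List.mem_reverse, List.mem_map, List.mem_flatten] at hM hN
  obtain ⟨g, ⟨s, hs, hg⟩, rfl⟩ := hM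
  obtain ⟨g', ⟨s', hs', hg'⟩, rfl⟩ := hN
  exact g.supportedOn_op.commute g'.supportedOn_op (h s hs g hg s' hs' g' hg')

/-- The circuit executing `A` and `B` side by side. -/
def par (A B : Circuit k) : Circuit k := List.zipWith (· ++ ·) A B

/-- The `i`-th slot of `A` contains only gates of the `i`-th type of `ts`. -/
def Shaped (ts : List GateType) (A : Circuit k) : Prop :=
  List.Forall₂ (fun τ s => ∀ g ∈ s, Gate.type g = τ) ts A

theorem Shaped.depth_le {ts : List GateType} {A : Circuit k} (h : Shaped ts A) (τ : GateType) :
    A.depth τ ≤ ts.count τ := by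
  unfold depth
  induction h with
  | nil => simp
  | @cons σ s ts A h1 _ ih =>
    rw [List.countP_cons, List.count_cons]
    refine add_le_add ih ?_
    by_cases hσ : σ = τ
    · simp only [hσ, beq_self_eq_true, if_true]
      split_ifs <;> simp
    · rw [if_neg]
      · simp
      · simp only [decide_eq_true_eq, not_exists, not_and]
        intro g hg hg'
        exact hσ ((h1 g hg).symm.trans hg')

theorem Shaped.par_op {ts : List GateType} {A B : Circuit k} (hA : Shaped ts A)
    (hB : Shaped ts B)
    (h : ∀ s ∈ A, ∀ g ∈ s, ∀ s' ∈ B, ∀ g' ∈ s', Disjoint g.support g'.support) :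
    (par A B).op = A.op * B.op ∧ ∀ τ, (par A B).cost τ = A.cost τ + B.cost τ := by
  induction hA generalizing B with
  | nil => cases hB; simp [par, op, cost]
  | @cons τ s ts A h1 _ ih =>
    cases hB with
    | @cons _ s' _ B h2 h3 =>
      have ih := ih h3 fun t ht g hg t' ht' => h t (List.mem_cons_of_mem _ ht) g hg t'
        (List.mem_cons_of_mem _ ht')
      have e1 : (par (s :: A) (s' :: B)) = ([s] ++ [s']).flatten :: par A B := by simp [par]
      have cons_op : ∀ (u : List (Gate k)) (C : Circuit k), op (u :: C) = op C * op [u] :=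
        fun u C => op_append [u] C
      have hc : Commute (op [s]) (op (s' :: B)) := by
        refine op_commute fun t ht g hg => h t ?_ g hg
        rw [List.mem_singleton.1 ht]
        exact List.mem_cons_self
      constructor
      · rw [e1, cons_op, ih.1, cons_op s, mul_assoc, mul_assoc, hc.eq, cons_op s', mul_assoc]
        simp [op]
      · intro τ
        have := ih.2 τ
        simp only [e1, cost, List.flatten_cons, List.countP_append] at this ⊢
        rw [this]
        simp
        omega

end Circuit

/-- `M` is the operator of a circuit of nearest-neighbor gates on the qubits of `S` whose `i`-th
slot contains only gates of type `ts i`, with at most `nc` `CNOT` gates, `nt` gates `T` or `T†`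
and `nh` Hadamard gates. -/
def Realizes (ts : List GateType) (S : Finset (Fin k)) (nc nt nh : ℕ) (M : Op k) : Prop :=
  ∃ A : Circuit k, A.IsValid ∧ A.IsLNN ∧ Circuit.Shaped ts A ∧
    (∀ s ∈ A, ∀ g ∈ s, g.support ⊆ S) ∧ A.op = M ∧
    A.cost .cnot ≤ nc ∧ A.cost .t ≤ nt ∧ A.cost .h ≤ nh

namespace Realizes

variable {ts ts' : List GateType} {S S' : Finset (Fin k)} {nc nt nh nc' nt' nh' : ℕ} {M M' : Op k}

theorem mono (h : Realizes ts S nc nt nh M) (hS : S ⊆ S') (hc : nc ≤ nc') (ht : nt ≤ nt')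
    (hh : nh ≤ nh') : Realizes ts S' nc' nt' nh' M := by
  obtain ⟨A, h1, h2, h3, h4, h5, h6, h7, h8⟩ := h
  exact ⟨A, h1, h2, h3, fun s hs g hg => (h4 s hs g hg).trans hS, h5, h6.trans hc, h7.trans ht,
    h8.trans hh⟩

/-- Sequential composition, the circuit of `M` being executed first. -/
theorem comp (h : Realizes ts S nc nt nh M) (h' : Realizes ts' S nc' nt' nh' M') :
    Realizes (ts ++ ts') S (nc + nc') (nt + nt') (nh + nh') (M' * M) := by
  obtain ⟨A, h1, h2, h3, h4, h5, h6, h7, h8⟩ := h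
  obtain ⟨B, g1, g2, g3, g4, g5, g6, g7, g8⟩ := h'
  have hc : ∀ τ, Circuit.cost (A ++ B) τ = A.cost τ + B.cost τ := fun τ => by
    simp [Circuit.cost]
  refine ⟨A ++ B, ?_, ?_, List.rel_append h3 g3, ?_, by rw [Circuit.op_append, h5, g5], ?_, ?_, ?_⟩
  · exact List.forall_mem_append.2 ⟨h1, g1⟩
  · exact List.forall_mem_append.2 ⟨h2, g2⟩
  · exact List.forall_mem_append.2 ⟨h4, g4⟩
  all_goals rw [hc]; omega

theorem par (h : Realizes ts S nc nt nh M) (h' : Realizes ts S' nc' nt' nh' M')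
    (hS : Disjoint S S') :
    Realizes ts (S ∪ S') (nc + nc') (nt + nt') (nh + nh') (M * M') := by
  obtain ⟨A, h1, h2, h3, h4, h5, h6, h7, h8⟩ := h
  obtain ⟨B, g1, g2, g3, g4, g5, g6, g7, g8⟩ := h'
  have hd : ∀ s ∈ A, ∀ g ∈ s, ∀ s' ∈ B, ∀ g' ∈ s', Disjoint g.support g'.support :=
    fun s hs g hg s' hs' g' hg' => Finset.disjoint_of_subset_left (h4 s hs g hg)
      (Finset.disjoint_of_subset_right (g4 s' hs' g' hg') hS)
  have hpar := Circuit.Shaped.par_op h3 g3 hd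
  have hmem : ∀ u ∈ Circuit.par A B, ∃ s ∈ A, ∃ s' ∈ B, u = s ++ s' := by
    intro u hu
    rw [Circuit.par, List.zipWith_eq_zipWith_take_min] at hu
    obtain ⟨i, hi, rfl⟩ := List.getElem_of_mem hu
    rw [List.getElem_zipWith]
    exact ⟨_, List.mem_of_mem_take (List.getElem_mem _), _,
      List.mem_of_mem_take (List.getElem_mem _), rfl⟩
  refine ⟨A.par B, ?_, ?_, ?_, ?_, by rw [hpar.1, h5, g5], ?_, ?_, ?_⟩
  · intro u hu
    obtain ⟨s, hs, s', hs', rfl⟩ := hmem u hu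
    exact List.pairwise_append.2 ⟨h1 s hs, g1 s' hs', fun g hg g' hg' => hd s hs g hg s' hs' g' hg'⟩
  · intro u hu
    obtain ⟨s, hs, s', hs', rfl⟩ := hmem u hu
    exact List.forall_mem_append.2 ⟨h2 s hs, g2 s' hs'⟩
  · clear h1 h2 h4 h5 h6 h7 h8 g1 g2 g4 g5 g6 g7 g8 hd hpar hmem
    induction h3 generalizing B with
    | nil => cases g3; exact List.Forall₂.nil
    | cons h _ ih =>
      cases g3 with
      | cons h' h'' => exact List.Forall₂.cons (List.forall_mem_append.2 ⟨h, h'⟩) (ih _ h'')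
  · intro u hu
    obtain ⟨s, hs, s', hs', rfl⟩ := hmem u hu
    exact List.forall_mem_append.2
      ⟨fun g hg => (h4 s hs g hg).trans Finset.subset_union_left,
        fun g hg => (g4 s' hs' g hg).trans Finset.subset_union_right⟩
  all_goals rw [hpar.2]; omega

theorem conjTranspose (h : Realizes ts S nc nt nh M) :
    Realizes ts.reverse S nc nt nh M.conjTranspose := by
  obtain ⟨A, h1, h2, h3, h4, h5, h6, h7, h8⟩ := h
  have hmem : ∀ u ∈ A.inv, ∃ s ∈ A, u = (s.map Gate.inv).reverse := by
    intro u hu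
    simp only [Circuit.inv, List.mem_reverse, List.mem_map] at hu
    obtain ⟨s, hs, rfl⟩ := hu
    exact ⟨s, hs, rfl⟩
  have hc : ∀ τ, A.inv.cost τ = A.cost τ := by
    intro τ
    rw [Circuit.cost, Circuit.inv_flatten, List.countP_reverse, List.countP_map]
    simp only [Circuit.cost]
    congr 1
    ext g
    simp [Gate.inv_type]
  refine ⟨A.inv, ?_, ?_, ?_, ?_, by rw [Circuit.inv_op h2, h5], ?_, ?_, ?_⟩
  · intro u hu
    obtain ⟨s, hs, rfl⟩ := hmem u hu
    rw [List.pairwise_reverse, List.pairwise_map]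
    exact (h1 s hs).imp fun {g g'} h => by rw [Gate.inv_support, Gate.inv_support]; exact h.symm
  · intro u hu g hg
    obtain ⟨s, hs, rfl⟩ := hmem u hu
    simp only [List.mem_reverse, List.mem_map] at hg
    obtain ⟨g, hg, rfl⟩ := hg
    exact Gate.inv_isLNN (h2 s hs g hg)
  · refine List.rel_reverse ?_
    rw [List.forall₂_map_right_iff]
    refine List.Forall₂.imp (fun τ s h g hg => ?_) h3
    simp only [List.mem_reverse, List.mem_map] at hg
    obtain ⟨g, hg, rfl⟩ := hg
    rw [Gate.inv_type, h g hg]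
  · intro u hu g hg
    obtain ⟨s, hs, rfl⟩ := hmem u hu
    simp only [List.mem_reverse, List.mem_map] at hg
    obtain ⟨g, hg, rfl⟩ := hg
    rw [Gate.inv_support]
    exact h4 s hs g hg
  all_goals rw [hc]; assumption

theorem unitary (h : Realizes ts S nc nt nh M) : M * M.conjTranspose = 1 := by
  obtain ⟨A, -, h2, -, -, rfl, -⟩ := h
  exact Circuit.op_unitary h2

theorem commute (h : Realizes ts S nc nt nh M) (h' : Realizes ts' S' nc' nt' nh' M')
    (hS : Disjoint S S') : Commute M M' := by
  obtain ⟨A, -, -, -, h4, rfl, -⟩ := h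
  obtain ⟨B, -, -, -, g4, rfl, -⟩ := h'
  exact Circuit.op_commute fun s hs g hg s' hs' g' hg' =>
    Finset.disjoint_of_subset_left (h4 s hs g hg)
      (Finset.disjoint_of_subset_right (g4 s' hs' g' hg') hS)

/-- The empty circuit, with any number of empty slots. -/
theorem one (ts : List GateType) (S : Finset (Fin k)) : Realizes ts S 0 0 0 (1 : Op k) := by
  refine ⟨ts.map fun _ => [], ?_, ?_, ?_, ?_, ?_, ?_, ?_, ?_⟩
  · intro s hs; simp_all
  · intro s hs; simp_all
  · rw [Circuit.Shaped, List.forall₂_map_right_iff, List.forall₂_same]; simp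
  · intro s hs; simp_all
  all_goals simp [Circuit.op, Circuit.cost]

/-- A single gate. -/
theorem gate {g : Gate k} (hg : g.IsLNN) :
    Realizes [g.type] g.support (if g.type = .cnot then 1 else 0) (if g.type = .t then 1 else 0)
      (if g.type = .h then 1 else 0) g.op := by
  refine ⟨[[g]], ?_, ?_, ?_, ?_, ?_, ?_, ?_, ?_⟩
  · intro s hs; simp_all
  · intro s hs; simp_all
  · exact List.Forall₂.cons (by simp) List.Forall₂.nil
  · intro s hs; simp_all
  · simp [Circuit.op]
  all_goals simp [Circuit.cost, List.countP_singleton]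

theorem cnot {a b : Fin k} (h : (a : ℕ) + 1 = b ∨ (b : ℕ) + 1 = a) :
    Realizes [.cnot] {a, b} 1 0 0 (permOp (cx a b)) := by
  rw [← cnot_op]
  exact gate (g := Gate.cnot a b) h

end Realizes

/-! ### The relative-phase Toffoli block -/

/-- A Hadamard gate may be moved through a monomial operator changing only its own qubit, provided
the two monomial operators match entrywise. -/
theorem hadamard_mul_monoOp {q : Fin k} {f g : (Fin k → Fin 2) → Fin k → Fin 2}
    {α β : (Fin k → Fin 2) → ℂ} (hf : ∀ w, ∀ j, j ≠ q → f w j = w j)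
    (hg : ∀ w, ∀ j, j ≠ q → g w j = w j) (hgg : ∀ w, g (g w) = w)
    (h : ∀ u w, (∀ j, j ≠ q → u j = w j) →
      hadamard (u q) (f w q) * α w = β (g u) * hadamard (g u q) (w q)) :
    onQubit hadamard q * monoOp f α = monoOp g β * onQubit hadamard q := by
  ext u w
  rw [mul_monoOp_apply, monoOp_mul_apply hgg hgg]
  by_cases huw : ∀ j, j ≠ q → u j = w j
  · rw [onQubit, onQubit, if_pos, if_pos, h u w huw]
    · intro j hj; rw [hg u j hj, huw j hj]
    · intro j hj; rw [hf w j hj, huw j hj]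
  · rw [onQubit, onQubit, if_neg, if_neg, zero_mul, mul_zero]
    · intro h'; exact huw fun j hj => by rw [← h' j hj, hg u j hj]
    · intro h'; exact huw fun j hj => by rw [h' j hj, hf w j hj]

/-- The four layers `H`, `CNOT`, `T`/`T†`, `CNOT` on the adjacent qubits `x, y`. Conjugation by
this operator turns a `CNOT` from a third qubit onto `x` into a Toffoli gate onto `y` up to phases.
As it does not involve the third qubit, the layers of different blocks can be executed in
parallel. -/
def blockK (x y : Fin k) : Op k :=
  permOp (cx x y) * ((Gate.t y).op * (Gate.tdg x).op) * permOp (cx y x) * (Gate.h y).op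

theorem realizes_blockK {x y : Fin k} (hxy : (x : ℕ) + 1 = y) :
    Realizes [.h, .cnot, .t, .cnot] {x, y} 2 2 1 (blockK x y) := by
  have hne : y ≠ x := by rintro rfl; omega
  have hh := Realizes.gate (g := Gate.h y) trivial
  have hc := Realizes.cnot (a := y) (b := x) (Or.inr hxy)
  have hc' := Realizes.cnot (a := x) (b := y) (Or.inl hxy)
  have ht := (Realizes.gate (g := Gate.t y) trivial).par (Realizes.gate (g := Gate.tdg x) trivial)
    (by simpa [Gate.support] using hne)
  have hS : ({y, x} : Finset (Fin k)) ⊆ {x, y} := by simp [Finset.pair_comm]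
  have := (((hh.mono (S' := {x, y}) (by simp [Gate.support]) le_rfl le_rfl le_rfl).comp
    (hc.mono hS le_rfl le_rfl le_rfl)).comp
      (ht.mono (S' := {x, y}) (by simp [Gate.support, Finset.insert_subset_iff])
        le_rfl le_rfl le_rfl)).comp hc'
  rw [blockK, mul_assoc, mul_assoc]
  exact this.mono le_rfl (by simp [Gate.type]) (by simp [Gate.type]) (by simp [Gate.type])

/-- Action of the Toffoli gate with controls `s, x` and target `y` on configurations. -/
def ccx (s x y : Fin k) (w : Fin k → Fin 2) : Fin k → Fin 2 :=
  Function.update w y (w y + w s * w x)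

theorem ccx_apply_self (s x y : Fin k) (w : Fin k → Fin 2) : ccx s x y w y = w y + w s * w x := by
  simp [ccx]

theorem ccx_apply_of_ne {s x y j : Fin k} (h : j ≠ y) (w : Fin k → Fin 2) :
    ccx s x y w j = w j := by
  simp [ccx, h]

theorem ccx_ccx {s x y : Fin k} (hs : s ≠ y) (hx : x ≠ y) (w : Fin k → Fin 2) :
    ccx s x y (ccx s x y w) = w := by
  ext j
  by_cases hj : j = y
  · subst hj
    rw [ccx_apply_self, ccx_apply_self, ccx_apply_of_ne hs, ccx_apply_of_ne hx,
      fin_two_add_add_self]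
  · rw [ccx_apply_of_ne hj, ccx_apply_of_ne hj]

/-- The phases of the relative-phase Toffoli gate with controls `s, x` and target `y`. -/
def blockPhase (s x y : Fin k) (w : Fin k → Fin 2) : ℂ :=
  if w s = 1 then (if w x = 1 then Complex.I else 1) * (if w y = 1 then -1 else 1) else 1

theorem blockPhase_mul_star (s x y : Fin k) (w : Fin k → Fin 2) :
    blockPhase s x y w * star (blockPhase s x y w) = 1 := by
  unfold blockPhase
  split_ifs <;> simp

/-- Conjugating `CNOT` from `s` to `x` by `blockK x y` gives a Toffoli gate onto `y` up to phases.
The diagonal part contributes `exp (i π / 4)` to the power `y - (x ⊕ y) - (s ⊕ y) + (s ⊕ x ⊕ y)`,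
and the flips of `y` by `s` become signs when the Hadamard gates are moved through. -/
theorem blockK_conj {s x y : Fin k} (hsx : s ≠ x) (hsy : s ≠ y) (hxy : x ≠ y) :
    (blockK x y).conjTranspose * permOp (cx s x) * blockK x y =
      monoOp (ccx s x y) (blockPhase s x y) := by
  -- `K` is a monomial operator after a Hadamard gate.
  set f : (Fin k → Fin 2) → Fin k → Fin 2 := cx x y ∘ cx y x with hf
  set g : (Fin k → Fin 2) → Fin k → Fin 2 := cx y x ∘ cx x y with hg
  set ω : (Fin k → Fin 2) → ℂ := fun w =>
    (if w y = 1 then ζ else 1) * (if w x + w y = 1 then star ζ else 1) with hω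
  have hfg : ∀ w, f (g w) = w := fun w => by
    simp only [hf, hg, Function.comp, cx_cx hxy, cx_cx hxy.symm]
  have hgf : ∀ w, g (f w) = w := fun w => by
    simp only [hf, hg, Function.comp, cx_cx hxy, cx_cx hxy.symm]
  have hK : blockK x y = monoOp f ω * onQubit hadamard y := by
    rw [blockK, t_op, tdg_op, monoOp_mul_monoOp, permOp, monoOp_mul_monoOp, permOp,
      monoOp_mul_monoOp, Gate.op]
    congr 2
    ext w
    simp [hω, cx_apply_self, cx_apply_of_ne hxy.symm]
  have hmid : g ∘ cx s x ∘ f = cx s y := by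
    ext w j
    have h0 : ∀ a b : Fin 2, a + (b + a) = b := by decide
    by_cases hjy : j = y
    · subst hjy
      simp [hf, hg, cx_apply_self, cx_apply_of_ne, hsx, hsy, hxy, hxy.symm, h0]
      generalize w x = a; generalize w s = b; generalize w j = c
      revert a b c; decide
    · by_cases hjx : j = x
      · subst hjx
        simp [hf, hg, cx_apply_self, cx_apply_of_ne, hsx, hsy, hxy, hxy.symm]
        generalize w j = a; generalize w s = b; generalize w y = c
        revert a b c; decide
      · simp [hf, hg, cx_apply_of_ne, hjx, hjy]
  have hω' : ∀ w, star (ω (cx s y w)) * ω w =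
      if w s = 1 then (if w x = 1 then Complex.I * (if w y = 1 then 1 else -1) else 1) else 1 := by
    intro w
    have hz : (starRingEnd ℂ) ζ * (starRingEnd ℂ) ζ = - Complex.I := by
      rw [← map_mul, ζ_mul_ζ]; simp
    have hz1 : ζ * (starRingEnd ℂ) ζ = 1 := ζ_mul_star
    have hz2 : (starRingEnd ℂ) ζ * ζ = 1 := by rw [mul_comm, hz1]
    simp only [hω, cx_apply_self, cx_apply_of_ne hxy]
    rcases fin_two_cases (w s) with h1 | h1 <;> rcases fin_two_cases (w x) with h2 | h2 <;>
      rcases fin_two_cases (w y) with h3 | h3 <;> simp [h1, h2, h3, hz, hz1, hz2, ζ_mul_ζ]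
  -- Moving the Hadamard gate through turns the flip by `s` into a sign, and the sign into a flip.
  have key : onQubit hadamard y * monoOp (cx s y) (fun w => star (ω (cx s y w)) * ω w) =
      monoOp (ccx s x y) (blockPhase s x y) * onQubit hadamard y := by
    refine hadamard_mul_monoOp (fun w j hj => cx_apply_of_ne hj w)
      (fun w j hj => ccx_apply_of_ne hj w) (ccx_ccx hsy hxy) fun u w huw => ?_
    rw [hω', blockPhase, ccx_apply_self, ccx_apply_of_ne hsy, ccx_apply_of_ne hxy, cx_apply_self,
      huw s hsy, huw x hxy]
    generalize u y = a; generalize w y = b; generalize w s = c; generalize w x = d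
    rcases fin_two_cases a with rfl | rfl <;> rcases fin_two_cases b with rfl | rfl <;>
      rcases fin_two_cases c with rfl | rfl <;> rcases fin_two_cases d with rfl | rfl <;>
        simp [hadamard_apply] <;> ring
  calc _ = onQubit hadamard y * ((monoOp f ω).conjTranspose * permOp (cx s x) * monoOp f ω) *
        onQubit hadamard y := by
        rw [hK, Matrix.conjTranspose_mul, hadamard_onQubit_conjTranspose]; noncomm_ring
    _ = onQubit hadamard y * monoOp (cx s y) (fun w => star (ω (cx s y w)) * ω w) *
        onQubit hadamard y := by
        rw [conjTranspose_monoOp hfg hgf, permOp, monoOp_mul_monoOp, monoOp_mul_monoOp]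
        congr 2
        rw [Function.comp_assoc, hmid]
        congr 1
        ext w
        have := congrFun hmid w
        simp only [Function.comp] at this
        simp [this]
    _ = _ := by
        rw [key, mul_assoc, hadamard_onQubit_mul_self, mul_one]

/-! ### Chains of `CNOT` gates and relative-phase Toffoli blocks -/

/-- Toggle the bit `z` if `v` is `1`. -/
def tog (z : Fin k) (v : (Fin k → Fin 2) → Fin 2) (w : Fin k → Fin 2) : Fin k → Fin 2 :=
  Function.update w z (w z + v w)

theorem tog_apply_self (z : Fin k) (v : (Fin k → Fin 2) → Fin 2) (w : Fin k → Fin 2) :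
    tog z v w z = w z + v w := by
  simp [tog]

theorem tog_apply_of_ne {z j : Fin k} (h : j ≠ z) (v : (Fin k → Fin 2) → Fin 2)
    (w : Fin k → Fin 2) : tog z v w j = w j := by
  simp [tog, h]

/-- Conjugating a toggle of `z` by a monomial operator that ignores `z` substitutes in its
condition, and all phases cancel. -/
theorem conj_tog {z : Fin k} {f g : (Fin k → Fin 2) → Fin k → Fin 2}
    {ω : (Fin k → Fin 2) → ℂ} (hfg : ∀ w, f (g w) = w) (hgf : ∀ w, g (f w) = w)
    (hω : ∀ w, ω w * star (ω w) = 1)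
    (hf : ∀ w b, f (Function.update w z b) = Function.update (f w) z b)
    (hfz : ∀ w, f w z = w z)
    (hωz : ∀ w b, ω (Function.update w z b) = ω w) (v : (Fin k → Fin 2) → Fin 2) :
    (monoOp f ω).conjTranspose * permOp (tog z v) * monoOp f ω = permOp (tog z (v ∘ f)) := by
  have key : ∀ w, g (tog z v (f w)) = tog z (v ∘ f) w := by
    intro w
    have : f (tog z (v ∘ f) w) = tog z v (f w) := by
      rw [tog, hf, tog, hfz]; rfl
    rw [← this, hgf]
  rw [conjTranspose_monoOp hfg hgf, permOp, monoOp_mul_monoOp, monoOp_mul_monoOp, permOp]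
  congr 1
  · ext w; simp only [Function.comp, key]
  · ext w
    simp only [key, mul_one]
    rw [tog, hωz, mul_comm, hω]

/-- The condition `v` of a toggle of `z` depends only on the wires in `[i, z)`, and on the wire `i`
in an affine way: flipping `i` changes `v` iff all wires of `X` in `(i, z)` are `1`. -/
structure AffineAt (X : Finset (Fin k)) (z i : Fin k) (v : (Fin k → Fin 2) → Fin 2) : Prop where
  congr : ∀ w w' : Fin k → Fin 2, (∀ j, i ≤ j → j < z → w j = w' j) → v w = v w'
  flip : ∀ w : Fin k → Fin 2, v (Function.update w i (w i + 1)) =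
    v w + if ∀ j ∈ X, i < j → j < z → w j = 1 then 1 else 0

/-- The source of a chain is moved back across an idle wire by a `CNOT`. -/
theorem AffineAt.cx {X : Finset (Fin k)} {z i i' : Fin k} {v : (Fin k → Fin 2) → Fin 2}
    (h : AffineAt X z i' v) (hi : (i : ℕ) + 1 = i') (hz : i' < z) (hX : i' ∉ X) :
    AffineAt X z i (v ∘ cx i i') := by
  have hne : i ≠ i' := by rintro rfl; omega
  have hlt : i < i' := by rw [Fin.lt_def]; omega
  constructor
  · intro w w' hw
    refine h.congr _ _ fun j hj hjz => ?_
    by_cases hji : j = i'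
    · subst hji
      rw [cx_apply_self, cx_apply_self, hw i le_rfl (hlt.trans hz), hw j hlt.le hjz]
    · rw [cx_apply_of_ne hji, cx_apply_of_ne hji, hw j (hlt.le.trans hj) hjz]
  · intro w
    have h1 : v (LNN.cx i i' (Function.update w i (w i + 1))) =
        v (Function.update (LNN.cx i i' w) i' (LNN.cx i i' w i' + 1)) := by
      refine h.congr _ _ fun j hj hjz => ?_
      by_cases hji : j = i'
      · subst hji
        simp [cx_apply_self, hne.symm, add_assoc]
      · have : j ≠ i := (hlt.trans_le hj).ne'
        simp [cx_apply_of_ne hji, hji, this]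
    simp only [Function.comp]
    rw [h1, h.flip]
    congr 1
    have : (∀ j ∈ X, i' < j → j < z → LNN.cx i i' w j = 1) ↔
        ∀ j ∈ X, i < j → j < z → w j = 1 := by
      refine forall₂_congr fun j hj => ?_
      have hji : j ≠ i' := fun h => hX (h ▸ hj)
      rw [cx_apply_of_ne hji]
      have : i' < j ↔ i < j := by
        rw [Fin.lt_def, Fin.lt_def]; have := Fin.val_ne_of_ne hji; omega
      rw [this]
    simp only [this]

/-- The source of a chain is moved back across a control wire `x` by a Toffoli gate. -/
theorem AffineAt.ccx {X : Finset (Fin k)} {z i x y : Fin k} {v : (Fin k → Fin 2) → Fin 2}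
    (h : AffineAt X z y v) (hx : (i : ℕ) + 1 = x) (hy : (x : ℕ) + 1 = y) (hz : y < z)
    (hxX : x ∈ X) (hyX : y ∉ X) :
    AffineAt X z i (v ∘ ccx i x y) := by
  have hix : i < x := by rw [Fin.lt_def]; omega
  have hxy : x < y := by rw [Fin.lt_def]; omega
  have hiy := hix.trans hxy
  constructor
  · intro w w' hw
    refine h.congr _ _ fun j hj hjz => ?_
    by_cases hjy : j = y
    · subst hjy
      rw [ccx_apply_self, ccx_apply_self, hw i le_rfl (hiy.trans hz), hw j hiy.le hjz,
        hw x hix.le (hxy.trans hz)]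
    · rw [ccx_apply_of_ne hjy, ccx_apply_of_ne hjy, hw j (hiy.le.trans hj) hjz]
  · intro w
    have hall : (∀ j ∈ X, i < j → j < z → w j = 1) ↔
        w x = 1 ∧ ∀ j ∈ X, y < j → j < z → LNN.ccx i x y w j = 1 := by
      constructor
      · intro h
        refine ⟨h x hxX hix (hxy.trans hz), fun j hj hyj hjz => ?_⟩
        rw [ccx_apply_of_ne hyj.ne']
        exact h j hj (hiy.trans hyj) hjz
      · rintro ⟨h1, h2⟩ j hj hij hjz
        by_cases hjx : j = x
        · rw [hjx, h1]
        · have hjy : j ≠ y := fun h => hyX (h ▸ hj)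
          rw [← ccx_apply_of_ne (s := i) (x := x) hjy w]
          refine h2 j hj ?_ hjz
          rw [Fin.lt_def] at *
          have := Fin.val_ne_of_ne hjy; have := Fin.val_ne_of_ne hjx; omega
    simp only [Function.comp]
    rcases fin_two_cases (w x) with hw | hw
    · have h1 : v (LNN.ccx i x y (Function.update w i (w i + 1))) = v (LNN.ccx i x y w) := by
        refine h.congr _ _ fun j hj hjz => ?_
        by_cases hjy : j = y
        · subst hjy
          simp [ccx_apply_self, hiy.ne', hix.ne', hw]
        · have : j ≠ i := (hiy.trans_le hj).ne'
          simp [ccx_apply_of_ne hjy, this]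
      rw [h1, if_neg, add_zero]
      rw [hall, hw]
      simp
    · have h1 : v (LNN.ccx i x y (Function.update w i (w i + 1))) =
          v (Function.update (LNN.ccx i x y w) y (LNN.ccx i x y w y + 1)) := by
        refine h.congr _ _ fun j hj hjz => ?_
        by_cases hjy : j = y
        · subst hjy
          simp [ccx_apply_self, hiy.ne', hix.ne', hw, add_assoc]
        · have : j ≠ i := (hiy.trans_le hj).ne'
          simp [ccx_apply_of_ne hjy, hjy, this]
      rw [h1, h.flip]
      simp only [hall, hw, true_and]

/-- Wires of `X` strictly between `i` and `z`. -/
def between (X : Finset (Fin k)) (i z : Fin k) : Finset (Fin k) :=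
  X.filter fun j => i < j ∧ j < z

/-- The chain from the wire `i` to `z = u + 1`. Its operator `W * K` conjugates the `CNOT` from `u`
to `z` into a toggle of `z` that responds to `i` exactly when all wires of `X` in between are `1`;
the wires in between start with arbitrary values, which only add terms independent of `i`. The
factor `K` collects the layers `blockK` of all blocks, executed in four common slots, and `W` holds
the sequential rest. The chain crosses `l` wires, two of them with each of its `p` blocks, and a
block costs three `CNOT` gates in `W`. -/
theorem exists_chain {X : Finset (Fin k)} {u z : Fin k} (hu : (u : ℕ) + 1 = z)
    (hadj : ∀ a ∈ X, ∀ b ∈ X, (a : ℕ) + 1 ≠ b) (hX : u ∉ X) (l : ℕ) (i : Fin k)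
    (hi : (i : ℕ) + l + 1 = z) :
    ∃ (ts : List GateType) (K W : Op k) (v : (Fin k → Fin 2) → Fin 2) (p : ℕ),
      (between X i z).card = p ∧
      Realizes [.h, .cnot, .t, .cnot] (Finset.Ioo i z) (2 * p) (2 * p) p K ∧
      Realizes ts (Finset.Ico i z) (l + p) (2 * p) p W ∧
      ts.count .cnot = l + p ∧ ts.count .t = p ∧ ts.count .h = p ∧
      (W * K).conjTranspose * permOp (cx u z) * (W * K) = permOp (tog z v) ∧
      AffineAt X z i v := by
  induction l using Nat.strong_induction_on generalizing i with
  | _ l ih =>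
  have hz : (z : ℕ) < k := z.2
  match l, ih, hi with
  | 0, _, hi =>
    have hiu : i = u := Fin.ext (by omega)
    subst hiu
    have hb : ∀ j, i < j → ¬ j < z := fun j h1 h2 => by rw [Fin.lt_def] at *; omega
    have hiz : i < z := by rw [Fin.lt_def]; omega
    refine ⟨[], 1, 1, fun w => w i, 0, ?_, Realizes.one _ _, Realizes.one _ _, rfl, rfl, rfl, ?_,
      fun w w' h => h i le_rfl hiz, fun w => ?_⟩
    · rw [between, Finset.card_eq_zero, Finset.filter_eq_empty_iff]
      exact fun j _ h => hb j h.1 h.2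
    · rw [mul_one, Matrix.conjTranspose_one, one_mul, mul_one]; rfl
    · rw [if_pos fun j _ h1 h2 => (hb j h1 h2).elim]; simp
  | l + 1, ih, hi =>
    obtain ⟨x, hx⟩ : ∃ x : Fin k, (i : ℕ) + 1 = x := ⟨⟨i + 1, by omega⟩, rfl⟩
    have hxz : x < z := by rw [Fin.lt_def]; omega
    have hix : i ≠ x := by rintro rfl; omega
    have hixl : i < x := by rw [Fin.lt_def]; omega
    by_cases hxX : x ∈ X
    · have hl : l ≠ 0 := by
        rintro rfl
        exact hX ((Fin.ext (by omega) : x = u) ▸ hxX)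
      obtain ⟨l, rfl⟩ := Nat.exists_eq_succ_of_ne_zero hl
      obtain ⟨y, hy⟩ : ∃ y : Fin k, (x : ℕ) + 1 = y := ⟨⟨x + 1, by omega⟩, rfl⟩
      have hyz : y < z := by rw [Fin.lt_def]; omega
      have hyX : y ∉ X := fun h => hadj x hxX y h hy
      have hxyl : x < y := by rw [Fin.lt_def]; omega
      have hiy : i < y := hixl.trans hxyl
      obtain ⟨ts, K, W, v, p, hp, hK, hW, hc, ht, hh, hWK, hv⟩ := ih l (by omega) y (by omega)
      have hB := realizes_blockK hy
      have hL := (Realizes.cnot (a := i) (b := x) (Or.inl hx)).mono (S' := {i, x, y})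
        (by simp [Finset.insert_subset_iff]) le_rfl le_rfl le_rfl
      have hBL := hL.comp ((hB.conjTranspose).mono (S' := {i, x, y})
        (by simp) le_rfl le_rfl le_rfl)
      have hd : Disjoint (Finset.Ioo y z) {i, x, y} := by
        simp [hiy.le, hxyl.le]
      have hcomm := hK.commute hBL hd
      have hsub : ({i, x, y} : Finset (Fin k)) ⊆ Finset.Ico i z := by
        simp [Finset.insert_subset_iff, hixl.le, hiy.le, hxz, hyz, hiy.trans hyz]
      refine ⟨([.cnot] ++ [.h, .cnot, .t, .cnot].reverse) ++ ts, K * blockK x y,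
        W * ((blockK x y).conjTranspose * permOp (cx i x)), v ∘ ccx i x y, p + 1, ?_, ?_, ?_, ?_, ?_, ?_, ?_, hv.ccx hx hy hyz hxX hyX⟩
      rotate_left
      · refine (hK.par hB (by simp [hxyl.le])).mono ?_ (by omega) (by omega) le_rfl
        refine Finset.union_subset (Finset.Ioo_subset_Ioo hiy.le le_rfl) ?_
        simp [Finset.insert_subset_iff, hixl, hiy, hxz, hyz]
      · exact ((hBL.mono hsub le_rfl le_rfl le_rfl).comp
          (hW.mono (Finset.Ico_subset_Ico hiy.le le_rfl) le_rfl le_rfl le_rfl)).mono le_rfl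
          (by omega) (by omega) (by omega)
      · simp [hc]; omega
      · simp [ht]
      · simp [hh]
      -- `K` acts beyond `y` only, so the layers `blockK x y` of the new block can join it.
      · have e1 : W * ((blockK x y).conjTranspose * permOp (cx i x)) * (K * blockK x y) =
            W * K * ((blockK x y).conjTranspose * permOp (cx i x) * blockK x y) := by
          rw [mul_assoc, ← mul_assoc _ K, ← hcomm.eq]; noncomm_ring
        have hfy : ∀ w b, ccx i x y (Function.update w z b) =
            Function.update (ccx i x y w) z b := by
          intro w b
          ext j
          by_cases hjz : j = z
          · subst hjz; simp [ccx_apply_of_ne hyz.ne']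
          · by_cases hjy : j = y
            · subst hjy; simp [ccx_apply_self, hjz, hxz.ne, (hixl.trans hxz).ne]
            · simp [ccx_apply_of_ne hjy, hjz]
        rw [e1, blockK_conj hix hiy.ne hxyl.ne, Matrix.conjTranspose_mul]
        calc _ = (monoOp (ccx i x y) (blockPhase i x y)).conjTranspose *
              ((W * K).conjTranspose * permOp (cx u z) * (W * K)) *
              monoOp (ccx i x y) (blockPhase i x y) := by noncomm_ring
          _ = _ := by
            rw [hWK]
            refine conj_tog (ccx_ccx hiy.ne hxyl.ne) (ccx_ccx hiy.ne hxyl.ne)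
              (blockPhase_mul_star i x y) hfy (fun w => ccx_apply_of_ne hyz.ne' w) ?_ v
            intro w b
            simp [blockPhase, hxz.ne, hyz.ne, (hixl.trans hxz).ne]
      · have : between X i z = insert x (between X y z) := by
          ext j
          simp only [between, Finset.mem_filter, Finset.mem_insert, Fin.lt_def]
          by_cases hjx : j = x
          · subst hjx; simp [hxX]; omega
          · by_cases hjy : j = y
            · subst hjy; simp [hyX, hjx]
            · have := Fin.val_ne_of_ne hjx; have := Fin.val_ne_of_ne hjy
              have : (i : ℕ) < j ↔ (y : ℕ) < j := by omega
              simp [hjx, this]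
        rw [this, Finset.card_insert_of_notMem, hp]
        simp [between, hxyl.le]
    · obtain ⟨ts, K, W, v, p, hp, hK, hW, hc, ht, hh, hWK, hv⟩ := ih l (by omega) x (by omega)
      have hL := (Realizes.cnot (a := i) (b := x) (Or.inl hx))
      have hd : Disjoint (Finset.Ioo x z) {i, x} := by
        simp [hixl.le]
      have hcomm := hK.commute hL hd
      have hsub : ({i, x} : Finset (Fin k)) ⊆ Finset.Ico i z := by
        simp [Finset.insert_subset_iff, hixl.le, hxz, hixl.trans hxz]
      refine ⟨[.cnot] ++ ts, K, W * permOp (cx i x),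
        v ∘ cx i x, p, ?_, hK.mono (Finset.Ioo_subset_Ioo hixl.le le_rfl) le_rfl le_rfl le_rfl,
        (hL.mono hsub le_rfl le_rfl le_rfl).comp
          (hW.mono (Finset.Ico_subset_Ico hixl.le le_rfl) le_rfl le_rfl le_rfl) |>.mono le_rfl
          (by omega) (by omega) (by omega), ?_, ?_, ?_, ?_, hv.cx hx hxz hxX⟩
      · rw [← hp]
        congr 1
        ext j
        simp only [between, Finset.mem_filter, Fin.lt_def, and_congr_right_iff]
        intro hj
        have : j ≠ x := fun h => hxX (h ▸ hj)
        have := Fin.val_ne_of_ne this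
        omega
      · simp [hc]; omega
      · simp [ht]
      · simp [hh]
      · have e1 : W * permOp (cx i x) * K = W * K * permOp (cx i x) := by
          rw [mul_assoc, ← hcomm.eq, mul_assoc]
        have hfy : ∀ w b, cx i x (Function.update w z b) = Function.update (cx i x w) z b := by
          intro w b
          ext j
          by_cases hjz : j = z
          · subst hjz; simp [cx_apply_of_ne hxz.ne']
          · by_cases hjy : j = x
            · subst hjy; simp [cx_apply_self, hjz, (hixl.trans hxz).ne]
            · simp [cx_apply_of_ne hjy, hjz]
        rw [e1, Matrix.conjTranspose_mul]
        calc _ = (permOp (cx i x)).conjTranspose *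
              ((W * K).conjTranspose * permOp (cx u z) * (W * K)) *
              permOp (cx i x) := by noncomm_ring
          _ = _ := by
            rw [hWK]
            exact conj_tog (cx_cx hix) (cx_cx hix) (by simp) hfy
              (fun w => cx_apply_of_ne hxz.ne' w) (by simp) v

/-! ### The multi-controlled gate with one dirty qubit -/

/-- The product of the bits in `E`. -/
def allOne (E : Finset (Fin k)) (w : Fin k → Fin 2) : Fin 2 := if ∀ e ∈ E, w e = 1 then 1 else 0

theorem allOne_congr {E : Finset (Fin k)} {w w' : Fin k → Fin 2} (h : ∀ e ∈ E, w e = w' e) :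
    allOne E w = allOne E w' := by
  have : (∀ e ∈ E, w e = 1) ↔ ∀ e ∈ E, w' e = 1 := forall₂_congr fun e he => by rw [h e he]
  simp only [allOne, this]

theorem allOne_union (A B : Finset (Fin k)) (w : Fin k → Fin 2) :
    allOne (A ∪ B) w = allOne A w * allOne B w := by
  simp only [allOne, Finset.mem_union, or_imp, forall_and]
  split_ifs <;> simp_all

theorem allOne_insert (a : Fin k) (B : Finset (Fin k)) (w : Fin k → Fin 2) :
    allOne (insert a B) w = w a * allOne B w := by
  rw [Finset.insert_eq, allOne_union]
  congr 1
  rcases fin_two_cases (w a) with h | h <;> simp [allOne, h]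

theorem AffineAt.flip_eq {X : Finset (Fin k)} {z i : Fin k} {v : (Fin k → Fin 2) → Fin 2}
    (h : AffineAt X z i v) (w : Fin k → Fin 2) :
    v (Function.update w i (w i + 1)) = v w + allOne (between X i z) w := by
  rw [h.flip]
  simp only [allOne, between, Finset.mem_filter, and_imp]

theorem cGate_singleton (E : Finset (Fin k)) (y : Fin k) :
    cGate E {y} = permOp (tog y (allOne E)) := by
  rw [cGate]
  congr 1
  ext w j
  by_cases hj : j = y
  · subst hj
    rw [tog_apply_self, cflip, allOne]
    split_ifs <;> simp_all
  · simp [tog_apply_of_ne hj, cflip, hj]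

/-- A Hadamard gate on the target turns a toggle into a sign. -/
theorem hadamard_mul_tog {X : Finset (Fin k)} {z i : Fin k} {v : (Fin k → Fin 2) → Fin 2}
    (h : AffineAt X z i v) :
    onQubit hadamard z * permOp (tog z v) =
      monoOp id (fun w => if w z = 1 ∧ v w = 1 then -1 else 1) * onQubit hadamard z := by
  refine hadamard_mul_monoOp (fun w j hj => tog_apply_of_ne hj v w) (fun _ _ _ => rfl)
    (fun _ => rfl) fun u w huw => ?_
  have : v u = v w := h.congr _ _ fun j _ hjz => huw j hjz.ne
  simp only [id, this, tog_apply_self, mul_one]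
  generalize u z = a; generalize w z = b; generalize v w = c
  rcases fin_two_cases a with rfl | rfl <;> rcases fin_two_cases b with rfl | rfl <;>
    rcases fin_two_cases c with rfl | rfl <;> simp [hadamard_apply]

/-- The sign that accompanies the toggle of the source `i` of a chain, once the end `z` has become
a control. It depends neither on the bit `i` nor on the wires beyond `z`. -/
def runSign (z i : Fin k) (v : (Fin k → Fin 2) → Fin 2) (w : Fin k → Fin 2) : ℂ :=
  if w z = 1 ∧ v (Function.update w i 0) = 1 then -1 else 1

/-- As the exponent of the sign is affine in the bit `i`, a Hadamard gate on `i` turns its linear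
part back into a toggle of `i`. -/
theorem hadamard_mul_sign {X : Finset (Fin k)} {z i : Fin k} {v : (Fin k → Fin 2) → Fin 2}
    (h : AffineAt X z i v) (hiz : i < z) :
    onQubit hadamard i * monoOp id (fun w => if w z = 1 ∧ v w = 1 then -1 else 1) =
      monoOp (tog i (allOne (insert z (between X i z)))) (runSign z i v) *
        onQubit hadamard i := by
  have hi : i ∉ insert z (between X i z) := by
    simp [between, hiz.ne]
  have hall : ∀ w, allOne (insert z (between X i z))
      (tog i (allOne (insert z (between X i z))) w) = allOne (insert z (between X i z)) w :=
    fun w => allOne_congr fun e he => tog_apply_of_ne (ne_of_mem_of_not_mem he hi) _ _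
  refine hadamard_mul_monoOp (fun _ _ _ => rfl) (fun w j hj => tog_apply_of_ne hj _ w)
    (fun w => ?_) fun u w huw => ?_
  · ext j
    by_cases hj : j = i
    · subst hj
      rw [tog_apply_self, hall, tog_apply_self, fin_two_add_add_self]
    · rw [tog_apply_of_ne hj, tog_apply_of_ne hj]
  · have h1 : Function.update (tog i (allOne (insert z (between X i z))) u) i 0 =
        Function.update u i 0 := by
      simp [tog]
    have h2 : Function.update u i 0 = Function.update w i 0 := by
      ext j
      by_cases hj : j = i
      · subst hj; simp
      · simp [hj, huw j hj]
    have h3 : allOne (between X i z) (Function.update w i 0) = allOne (between X i z) w := by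
      refine allOne_congr fun e he => ?_
      rw [Function.update_of_ne]
      rintro rfl
      simp [between] at he
    have h4 : v w = v (Function.update w i 0) + w i * allOne (between X i z) w := by
      rcases fin_two_cases (w i) with hw | hw
      · rw [hw, zero_mul, add_zero, ← hw, Function.update_eq_self]
      · rw [hw, one_mul, ← h3, ← h.flip_eq]
        congr 1
        simp [← hw]
    have h5 : allOne (between X i z) u = allOne (between X i z) w :=
      allOne_congr fun e he => huw e fun h => hi (Finset.mem_insert_of_mem (h ▸ he))
    simp only [id, runSign, h1, h2, tog_apply_self, tog_apply_of_ne hiz.ne', huw z hiz.ne',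
      allOne_insert, h4, h5]
    generalize u i = a; generalize w i = b; generalize v (Function.update w i 0) = c
    generalize w z = d; generalize allOne (between X i z) w = e
    rcases fin_two_cases a with rfl | rfl <;> rcases fin_two_cases b with rfl | rfl <;>
      rcases fin_two_cases c with rfl | rfl <;> rcases fin_two_cases d with rfl | rfl <;>
        rcases fin_two_cases e with rfl | rfl <;> simp [hadamard_apply]

/-- Conjugating a toggle of the end `z` of a chain by Hadamard gates on its two ends exchanges
their roles: up to signs, the source is toggled under the control of `z` and the wires of `X`. -/
theorem hadamard_conj_tog {X : Finset (Fin k)} {z i : Fin k} {v : (Fin k → Fin 2) → Fin 2}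
    (h : AffineAt X z i v) (hiz : i < z) :
    (onQubit hadamard z * onQubit hadamard i).conjTranspose * permOp (tog z v) *
      (onQubit hadamard z * onQubit hadamard i) =
      monoOp (tog i (allOne (insert z (between X i z)))) (runSign z i v) := by
  rw [Matrix.conjTranspose_mul, hadamard_onQubit_conjTranspose, hadamard_onQubit_conjTranspose]
  calc _ = onQubit hadamard i * (onQubit hadamard z * permOp (tog z v)) * onQubit hadamard z *
        onQubit hadamard i := by noncomm_ring
    _ = onQubit hadamard i * monoOp id (fun w => if w z = 1 ∧ v w = 1 then -1 else 1) *
        (onQubit hadamard z * onQubit hadamard z) * onQubit hadamard i := by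
        rw [hadamard_mul_tog h]; noncomm_ring
    _ = _ := by
        rw [hadamard_onQubit_mul_self, mul_one, hadamard_mul_sign h hiz, mul_assoc,
          hadamard_onQubit_mul_self, mul_one]

/-- The group commutator of two controlled flips through the dirty qubit `d` is the flip of `y`
controlled by both sets of controls. The toggle of `d` squares to the identity, and its signs
cancel as they depend neither on `d` nor on `y`. -/
theorem commutator_eq {A B : Finset (Fin k)} {d y z : Fin k}
    {v v' : (Fin k → Fin 2) → Fin 2} {X Y : Finset (Fin k)} (hdy : d < y) (hzy : z < y)
    (hdz : d < z) (hv : AffineAt X z d v) (hv' : AffineAt Y y d v')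
    (hA : insert z (between X d z) = A) (hB : between Y d y = B) :
    monoOp (tog d (allOne A)) (runSign z d v) * permOp (tog y v') *
      (monoOp (tog d (allOne A)) (runSign z d v) * permOp (tog y v')) = cGate (A ∪ B) {y} := by
  have hdA : d ∉ A := by rw [← hA]; simp [between, hdz.ne]
  have hyA : y ∉ A := by rw [← hA]; simp [between, hzy.ne', hzy.le]
  set χ := allOne A with hχ
  set φ := runSign z d v with hφ
  have hχd : ∀ w b, χ (Function.update w d b) = χ w := fun w b => allOne_congr fun e he =>
    Function.update_of_ne (fun h => hdA (by rwa [← h])) _ _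
  have hχy : ∀ w b, χ (Function.update w y b) = χ w := fun w b => allOne_congr fun e he =>
    Function.update_of_ne (fun h => hyA (by rwa [← h])) _ _
  have hφd : ∀ w b, φ (Function.update w d b) = φ w := by
    intro w b
    simp [hφ, runSign, hdz.ne']
  have hφy : ∀ w b, φ (Function.update w y b) = φ w := by
    intro w b
    have : v (Function.update (Function.update w y b) d 0) = v (Function.update w d 0) := by
      refine hv.congr _ _ fun j _ hj => ?_
      rw [Function.update_comm hdy.ne', Function.update_of_ne (hj.trans hzy).ne]
    simp [hφ, runSign, hzy.ne, this]
  have hφφ : ∀ w, φ w * φ w = 1 := by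
    intro w
    simp only [hφ, runSign]
    split_ifs <;> simp
  have hv'y : ∀ w b, v' (Function.update w y b) = v' w := fun w b =>
    hv'.congr _ _ fun j _ hj => Function.update_of_ne hj.ne _ _
  have hv'd : ∀ w, v' (tog d χ w) = v' w + χ w * allOne B w := by
    intro w
    rcases fin_two_cases (χ w) with h | h
    · rw [tog, h]; simp
    · rw [tog, h, hv'.flip_eq, hB, one_mul]
  have hBy : ∀ w b, allOne B (Function.update w y b) = allOne B w := fun w b =>
    allOne_congr fun e he => Function.update_of_ne (by rintro rfl; simp [← hB, between] at he) _ _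
  rw [cGate_singleton, permOp, monoOp_mul_monoOp, monoOp_mul_monoOp, permOp]
  congr 1
  · ext w j
    have e1 : tog y v' (tog d χ (tog y v' w)) = tog d χ (tog y (allOne (A ∪ B)) w) := by
      ext j
      by_cases hjd : j = d
      · subst hjd
        rw [tog_apply_of_ne hdy.ne, tog_apply_self, tog_apply_of_ne hdy.ne, tog_apply_self,
          tog_apply_of_ne hdy.ne, tog, tog, hχy, hχy]
      by_cases hjy : j = y
      · subst hjy
        rw [tog_apply_self, hv'd, tog_apply_of_ne hdy.ne', tog_apply_of_ne hdy.ne', tog_apply_self,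
          tog_apply_self, tog, hχy, hBy, hv'y, allOne_union, add_assoc, ← add_assoc (v' w),
          fin_two_add_self, zero_add]
      · simp only [tog_apply_of_ne hjd, tog_apply_of_ne hjy]
    have e2 : ∀ w, tog d χ (tog d χ w) = w := by
      intro w
      ext j
      by_cases hjd : j = d
      · subst hjd
        rw [tog_apply_self, tog_apply_self, tog, hχd, fin_two_add_add_self]
      · simp only [tog_apply_of_ne hjd]
    simp only [Function.comp, e1, e2]
  · ext w
    simp only [Function.comp, mul_one]
    rw [tog, hφy, tog, hφd, tog, hφy, hφφ]

/-- Conjugation of `N` by `M`: the circuit of `M`, that of `N`, and the inverse of the first. -/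
theorem Realizes.conj {ts ts' : List GateType} {S S' : Finset (Fin k)}
    {nc nt nh nc' nt' nh' : ℕ} {M N : Op k} (h : Realizes ts S nc nt nh M)
    (h' : Realizes ts' S' nc' nt' nh' N) :
    Realizes (ts ++ (ts' ++ ts.reverse)) Finset.univ (2 * nc + nc') (2 * nt + nt') (2 * nh + nh')
      (M.conjTranspose * N * M) := by
  have h1 := h.mono (Finset.subset_univ S) le_rfl le_rfl le_rfl
  exact (h1.comp ((h'.mono (Finset.subset_univ _) le_rfl le_rfl le_rfl).comp
    h1.conjTranspose)).mono le_rfl (by omega) (by omega) (by omega)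

/-- The gate flipping the last qubit under the control of the qubits of `E`, with the first qubit
as a dirty ancilla. -/
theorem realizes_cGate_last {E : Finset (Fin k)} {d y : Fin k} (hd : (d : ℕ) = 0)
    (hy : (y : ℕ) + 1 = k) (hdE : d ∉ E) (hyE : y ∉ E) (hE : E.Nonempty) :
    ∃ ts, Realizes ts Finset.univ (8 * k + 12 * E.card - 28) (16 * E.card - 16) (8 * E.card)
      (cGate E {y}) ∧ ts.count .cnot ≤ 8 * k + 4 * E.card - 4 ∧
      ts.count .t ≤ 4 * E.card + 4 ∧ ts.count .h ≤ 4 * E.card + 4 := by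
  set z := E.max' hE with hz
  have hzE : z ∈ E := E.max'_mem hE
  have hle : ∀ e ∈ E, e ≤ z := fun e he => E.le_max' e he
  have hpos : ∀ e ∈ E, d < e := fun e he => by
    have : e ≠ d := fun h => hdE (h ▸ he)
    have := Fin.val_ne_of_ne this
    rw [Fin.lt_def]; omega
  have hlt : ∀ e ∈ E, e < y := fun e he => by
    have : e ≠ y := fun h => hyE (h ▸ he)
    have := Fin.val_ne_of_ne this
    rw [Fin.lt_def]; omega
  have hdz := hpos z hzE
  have hzy := hlt z hzE
  have hdy := hdz.trans hzy
  have hdz' := Fin.lt_def.1 hdz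
  have hzy' := Fin.lt_def.1 hzy
  -- Controls are split by the parity of their positions, so that neither part has neighbors.
  set A := E.filter fun e : Fin k => (e : ℕ) % 2 = (z : ℕ) % 2 with hA
  set B := E.filter fun e : Fin k => ¬ (e : ℕ) % 2 = (z : ℕ) % 2 with hB
  have hAB : A ∪ B = E := Finset.filter_union_filter_not_eq _ _
  have hcard : A.card + B.card = E.card := Finset.card_filter_add_card_filter_not _
  have hzA : z ∈ A := by simp [hA, hzE]
  have hA1 : insert z (between A d z) = A := by
    ext j
    simp only [between, Finset.mem_insert, Finset.mem_filter]
    constructor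
    · rintro (rfl | h)
      exacts [hzA, h.1]
    · intro hj
      have hjE := (Finset.mem_filter.1 hj).1
      rcases (hle j hjE).eq_or_lt with h | h
      exacts [Or.inl h, Or.inr ⟨hj, hpos j hjE, h⟩]
  have hB1 : between B d y = B := by
    refine Finset.filter_true_of_mem fun j hj => ?_
    have hjE := (Finset.mem_filter.1 hj).1
    exact ⟨hpos j hjE, hlt j hjE⟩
  have hcA : (between A d z).card + 1 = A.card := by
    rw [← Finset.card_insert_of_notMem (a := z), hA1]
    simp [between]
  obtain ⟨u, hu⟩ : ∃ u : Fin k, (u : ℕ) + 1 = z := ⟨⟨z - 1, by omega⟩, by simp; omega⟩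
  obtain ⟨u', hu'⟩ : ∃ u : Fin k, (u : ℕ) + 1 = y := ⟨⟨y - 1, by omega⟩, by simp; omega⟩
  -- The largest control `z` serves as the end of the chain through `A`, and `y` as the end of the
  -- chain through `B`.
  obtain ⟨ts, K, W, v, p, hp, hK, hW, hc, ht, hh, hWK, hv⟩ := exists_chain (X := A) hu
    (fun a ha b hb => by
      have := (Finset.mem_filter.1 ha).2; have := (Finset.mem_filter.1 hb).2; omega)
    (fun h => by have := (Finset.mem_filter.1 h).2; omega) (z - 1) d (by omega)
  obtain ⟨ts', K', W', v', p', hp', hK', hW', hc', ht', hh', hWK', hv'⟩ :=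
    exists_chain (X := B) hu'
    (fun a ha b hb => by
      have := (Finset.mem_filter.1 ha).2; have := (Finset.mem_filter.1 hb).2; omega)
    (fun h => by
      have h1 := (Finset.mem_filter.1 h).2
      have h2 := Fin.le_def.1 (hle u' (Finset.mem_filter.1 h).1)
      exact h1 (by rw [show (u' : ℕ) = z by omega])) (k - 2) d (by omega)
  have hH : Realizes [.h, .cnot, .t, .cnot] {z, d} 0 0 2
      (onQubit hadamard z * onQubit hadamard d) := by
    have h1 := (Realizes.gate (g := Gate.h z) trivial).par (Realizes.gate (g := Gate.h d) trivial)
      (by simpa [Gate.support] using hdz.ne')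
    have := h1.comp (Realizes.one [.cnot, .t, .cnot] _)
    rw [one_mul] at this
    exact this
  -- The Hadamard gates of the role exchange fit into the first slot of the chain.
  have hKH := hK.par hH (by simp)
  have hRA := ((hKH.mono (Finset.subset_univ _) le_rfl le_rfl le_rfl).comp
    (hW.mono (Finset.subset_univ _) le_rfl le_rfl le_rfl)).conj (Realizes.cnot (Or.inl hu))
  have hRB := ((hK'.mono (Finset.subset_univ _) le_rfl le_rfl le_rfl).comp
    (hW'.mono (Finset.subset_univ _) le_rfl le_rfl le_rfl)).conj (Realizes.cnot (Or.inl hu'))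
  have eA : (W * (K * (onQubit hadamard z * onQubit hadamard d))).conjTranspose *
      permOp (cx u z) * (W * (K * (onQubit hadamard z * onQubit hadamard d))) =
      monoOp (tog d (allOne A)) (runSign z d v) := by
    rw [← hA1, ← hadamard_conj_tog hv hdz, ← hWK]
    simp only [Matrix.conjTranspose_mul, mul_assoc]
  rw [eA] at hRA
  rw [hWK'] at hRB
  have hAB' := hRB.comp hRA
  have hfin := hAB'.comp hAB'
  rw [commutator_eq hdy hzy hdz hv hv' hA1 hB1, hAB] at hfin
  rw [hp] at hcA
  rw [hB1] at hp'
  refine ⟨_, hfin.mono le_rfl ?_ ?_ ?_, ?_, ?_, ?_⟩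
  · omega
  · omega
  · omega
  · simp [hc, hc']; omega
  · simp [ht, ht']; omega
  · simp [hh, hh']; omega

/-! ### Moving controls and targets by `CNOT` conjugation -/

/-- `M` is realized by nearest-neighbor `CNOT` gates, with cost and depth at most `N`. -/
def CnotRealizes (N : ℕ) (M : Op k) : Prop :=
  ∃ ts : List GateType, Realizes ts Finset.univ N 0 0 M ∧ ts.count .cnot ≤ N ∧
    ts.count .t = 0 ∧ ts.count .h = 0

theorem CnotRealizes.comp {N N' : ℕ} {M M' : Op k} (h : CnotRealizes N M)
    (h' : CnotRealizes N' M') : CnotRealizes (N + N') (M' * M) := by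
  obtain ⟨ts, h1, h2, h3, h4⟩ := h
  obtain ⟨ts', g1, g2, g3, g4⟩ := h'
  exact ⟨ts ++ ts', (h1.comp g1).mono (by simp) le_rfl le_rfl le_rfl,
    by rw [List.count_append]; omega, by rw [List.count_append, h3, g3],
    by rw [List.count_append, h4, g4]⟩

theorem CnotRealizes.cx {a b : Fin k} (h : (a : ℕ) + 1 = b ∨ (b : ℕ) + 1 = a) :
    CnotRealizes 1 (permOp (cx a b)) :=
  ⟨[.cnot], (Realizes.cnot h).mono (Finset.subset_univ _) le_rfl le_rfl le_rfl, by simp, by simp,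
    by simp⟩

/-- Conjugation by at most `N` nearest-neighbor `CNOT` gates turns the flip of `F` controlled by
`E` into the flip of `F'` controlled by `E'`. -/
def Reduces (N : ℕ) (E F E' F' : Finset (Fin k)) : Prop :=
  ∃ M, CnotRealizes N M ∧ M * cGate E F = cGate E' F' * M

theorem Reduces.refl (E F : Finset (Fin k)) : Reduces 0 E F E F :=
  ⟨1, ⟨[], Realizes.one _ _, by simp, by simp, by simp⟩, by simp⟩

theorem Reduces.trans {N N' : ℕ} {E F E' F' E'' F'' : Finset (Fin k)} (h : Reduces N E F E' F')
    (h' : Reduces N' E' F' E'' F'') : Reduces (N + N') E F E'' F'' := by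
  obtain ⟨M, h1, h2⟩ := h
  obtain ⟨M', h1', h2'⟩ := h'
  exact ⟨M' * M, h1.comp h1', by rw [mul_assoc, h2, ← mul_assoc, h2', mul_assoc]⟩

/-- A ladder of `CNOT` gates adds to bit `a` a parity of the bits in `(a, b]` involving bit `b`. -/
theorem exists_ladder (a : Fin k) (l : ℕ) (b : Fin k) (hb : (a : ℕ) + l + 1 = b) :
    ∃ s : (Fin k → Fin 2) → Fin 2, CnotRealizes (2 * l + 1) (permOp (tog a s)) ∧
      (∀ w w' : Fin k → Fin 2, (∀ j, a < j → j ≤ b → w j = w' j) → s w = s w') ∧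
      ∀ w, s (Function.update w b (w b + 1)) = s w + 1 := by
  induction l generalizing b with
  | zero =>
    refine ⟨fun w => w b, CnotRealizes.cx (a := b) (b := a) (Or.inr (by omega)), ?_, ?_⟩
    · exact fun w w' h => h b (by rw [Fin.lt_def]; omega) le_rfl
    · intro w; simp
  | succ l ih =>
    have hbk := b.2
    obtain ⟨c, hc⟩ : ∃ c : Fin k, (c : ℕ) + 1 = b := ⟨⟨b - 1, by omega⟩, by simp; omega⟩
    obtain ⟨s, h1, h2, h3⟩ := ih c (by omega)
    have hac : a < c := by rw [Fin.lt_def]; omega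
    have hcb : c < b := by rw [Fin.lt_def]; omega
    have hab := hac.trans hcb
    refine ⟨s ∘ cx b c, ?_, ?_, ?_⟩
    · have hx := CnotRealizes.cx (a := b) (b := c) (Or.inr hc)
      have := (hx.comp h1).comp hx
      have e : permOp (cx b c) * (permOp (tog a s) * permOp (cx b c)) =
          permOp (tog a (s ∘ cx b c)) := by
        rw [permOp_mul_permOp, permOp_mul_permOp]
        congr 1
        ext w j
        by_cases hja : j = a
        · subst hja
          simp [cx_apply_of_ne hac.ne, tog_apply_self]
        · by_cases hjc : j = c
          · subst hjc
            simp [cx_apply_self, tog_apply_of_ne hja, tog_apply_of_ne hab.ne', cx_apply_of_ne hcb.ne',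
              fin_two_add_add_self]
          · simp [cx_apply_of_ne hjc, tog_apply_of_ne hja]
      rw [e] at this
      rwa [show 2 * (l + 1) + 1 = 1 + (2 * l + 1) + 1 by ring]
    · intro w w' hw
      refine h2 _ _ fun j haj hjc => ?_
      by_cases hj : j = c
      · subst hj
        rw [cx_apply_self, cx_apply_self, hw j haj hcb.le, hw b hab le_rfl]
      · rw [cx_apply_of_ne hj, cx_apply_of_ne hj, hw j haj (hjc.trans hcb.le)]
    · intro w
      simp only [Function.comp]
      rw [← h3]
      refine h2 _ _ fun j haj hjc => ?_
      by_cases hj : j = c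
      · subst hj
        simp [cx_apply_self, hcb.ne, add_assoc]
      · simp [cx_apply_of_ne hj, hj, (hjc.trans_lt hcb).ne]

theorem cflip_of_pos {E F : Finset (Fin k)} {w : Fin k → Fin 2} (h : ∀ e ∈ E, w e = 1)
    (j : Fin k) : cflip E F w j = if j ∈ F then w j + 1 else w j := by
  simp only [cflip, and_iff_left h]

theorem cflip_of_neg {E F : Finset (Fin k)} {w : Fin k → Fin 2} (h : ¬ ∀ e ∈ E, w e = 1) :
    cflip E F w = w := by
  ext j
  rw [cflip, if_neg fun h' => h h'.2]

/-- The leftmost of two consecutive targets can be removed. -/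
theorem Reduces.erase {E F : Finset (Fin k)} {a b : Fin k} (hEF : Disjoint E F) (ha : a ∈ F)
    (hb : b ∈ F) (hab : a < b) (hF : ∀ f ∈ F, a < f → b ≤ f) (l : ℕ)
    (hl : (a : ℕ) + l + 1 = b) : Reduces (2 * l + 1) E F E (F.erase a) := by
  obtain ⟨s, h1, h2, h3⟩ := exists_ladder a l b hl
  refine ⟨_, h1, ?_⟩
  rw [cGate, cGate, permOp_mul_permOp, permOp_mul_permOp]
  congr 1
  have haE : a ∉ E := Finset.disjoint_right.1 hEF ha
  ext w j
  have hcond : (∀ e ∈ E, tog a s w e = 1) ↔ ∀ e ∈ E, w e = 1 :=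
    forall₂_congr fun e he => by rw [tog_apply_of_ne (ne_of_mem_of_not_mem he haE)]
  by_cases hc : ∀ e ∈ E, w e = 1
  · have hs : s (cflip E F w) = s w + 1 := by
      rw [← h3]
      refine h2 _ _ fun j haj hjb => ?_
      rw [cflip_of_pos hc]
      by_cases hj : j = b
      · subst hj; simp [hb]
      · have : j ∉ F := fun h => hj (le_antisymm hjb (hF j h haj))
        simp [hj, this]
    have h4 : ∀ x y : Fin 2, x + 1 + (y + 1) = x + y := by decide
    simp only [Function.comp]
    rw [cflip_of_pos (hcond.2 hc)]
    by_cases hj : j = a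
    · subst hj
      simp [tog_apply_self, hs, cflip_of_pos hc, ha, h4]
    · simp [tog_apply_of_ne hj, cflip_of_pos hc, hj]
  · simp only [Function.comp]
    rw [cflip_of_neg hc, cflip_of_neg (mt hcond.1 hc)]

/-- Two `CNOT` gates exchange the roles of adjacent qubits, if the first is not a control and the
second is not a target. -/
theorem Reduces.swap {E F : Finset (Fin k)} {a b : Fin k}
    (h : (a : ℕ) + 1 = b ∨ (b : ℕ) + 1 = a) (ha : a ∉ E) (hb : b ∉ F) :
    Reduces 2 E F (E.map (Equiv.swap a b).toEmbedding) (F.map (Equiv.swap a b).toEmbedding) := by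
  have hab : a ≠ b := by rintro rfl; omega
  refine ⟨_, (CnotRealizes.cx h).comp (CnotRealizes.cx h.symm), ?_⟩
  rw [cGate, cGate, permOp_mul_permOp, permOp_mul_permOp, permOp_mul_permOp]
  congr 1
  have h0 : ∀ x y : Fin 2, x + (y + x) = y := by decide
  have hda : ∀ w : Fin k → Fin 2, (cx b a ∘ cx a b) w a = w b := fun w => by
    simp [cx_apply_self, cx_apply_of_ne hab, h0]
  have hdb : ∀ w : Fin k → Fin 2, (cx b a ∘ cx a b) w b = w b + w a := fun w => by
    simp [cx_apply_self, cx_apply_of_ne hab.symm]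
  have hdj : ∀ (w : Fin k → Fin 2) j, j ≠ a → j ≠ b → (cx b a ∘ cx a b) w j = w j :=
    fun w j h1 h2 => by simp [cx_apply_of_ne h1, cx_apply_of_ne h2]
  generalize cx b a ∘ cx a b = f at hda hdb hdj
  ext w j
  have hcond : (∀ e ∈ E.map (Equiv.swap a b).toEmbedding, f w e = 1) ↔ ∀ e ∈ E, w e = 1 := by
    rw [Finset.forall_mem_map]
    refine forall₂_congr fun e he => ?_
    have hea : e ≠ a := ne_of_mem_of_not_mem he ha
    by_cases heb : e = b
    · subst heb; simp [hda]
    · simp [Equiv.swap_apply_of_ne_of_ne hea heb, hdj w e hea heb]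
  have hF : ∀ j, j ∈ F.map (Equiv.swap a b).toEmbedding ↔ Equiv.swap a b j ∈ F := fun j => by
    rw [Finset.mem_map_equiv, Equiv.symm_swap]
  have hj : ∀ j, cflip (E.map (Equiv.swap a b).toEmbedding) (F.map (Equiv.swap a b).toEmbedding)
      (f w) j = if Equiv.swap a b j ∈ F ∧ ∀ e ∈ E, w e = 1 then f w j + 1 else f w j := fun j => by
    simp only [cflip, hcond, hF]
  simp only [Function.comp, hj]
  by_cases hja : j = a
  · subst hja
    simp [hda, hb, cflip]
  · by_cases hjb : j = b
    · subst hjb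
      simp only [hdb, cflip, Equiv.swap_apply_right, hb, false_and, if_false]
      split_ifs
      · rw [add_assoc]
      · rfl
    · simp [hdj _ j hja hjb, Equiv.swap_apply_of_ne_of_ne hja hjb, cflip]

/-- All targets are merged into the last qubit `y`, without changing anything before the
leftmost target `i`. -/
theorem exists_reduces_pass {y : Fin k} (hy : (y : ℕ) + 1 = k) (l : ℕ) (i : Fin k)
    (hi : (i : ℕ) + l = y) (E F : Finset (Fin k)) (hEF : Disjoint E F) (hiF : i ∈ F)
    (hF : ∀ f ∈ F, i ≤ f) :
    ∃ (N : ℕ) (E' : Finset (Fin k)), N + F.card = 2 * l + 1 ∧ Reduces N E F E' {y} ∧ y ∉ E' ∧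
      E'.card = E.card ∧ ∀ j, j < i → (j ∈ E' ↔ j ∈ E) := by
  induction l generalizing i E F with
  | zero =>
    have hiy : i = y := Fin.ext (by omega)
    subst hiy
    have : F = {i} := by
      refine Finset.eq_singleton_iff_unique_mem.2 ⟨hiF, fun f hf => le_antisymm ?_ (hF f hf)⟩
      rw [Fin.le_def]; omega
    subst this
    exact ⟨0, E, by simp, Reduces.refl _ _, Finset.disjoint_singleton_right.1 hEF, rfl,
      fun _ _ => Iff.rfl⟩
  | succ l ih =>
    obtain ⟨x, hx⟩ : ∃ x : Fin k, (i : ℕ) + 1 = x := ⟨⟨i + 1, by omega⟩, rfl⟩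
    have hix : i < x := by rw [Fin.lt_def]; omega
    have hnext : ∀ f, i < f → x ≤ f := fun f hf => by rw [Fin.lt_def] at hf; rw [Fin.le_def]; omega
    have hiE : i ∉ E := Finset.disjoint_right.1 hEF hiF
    by_cases hxF : x ∈ F
    · obtain ⟨N, E', h1, h2, h3, h4, h5⟩ := ih x (by omega) E (F.erase i)
        (Finset.disjoint_of_subset_right (Finset.erase_subset _ _) hEF)
        (Finset.mem_erase.2 ⟨hix.ne', hxF⟩) (fun f hf => by
          rw [Finset.mem_erase] at hf
          exact hnext f (lt_of_le_of_ne (hF f hf.2) hf.1.symm))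
      have hs := Reduces.erase hEF hiF hxF hix (fun f _ => hnext f) 0 (by omega)
      refine ⟨1 + N, E', ?_, hs.trans h2, h3, h4, fun j hj => h5 j (hj.trans hix)⟩
      have := Finset.card_erase_add_one hiF
      omega
    · have hs := Reduces.swap (Or.inl hx) hiE hxF
      obtain ⟨N, E', h1, h2, h3, h4, h5⟩ := ih x (by omega)
        (E.map (Equiv.swap i x).toEmbedding) (F.map (Equiv.swap i x).toEmbedding)
        ((Finset.disjoint_map _).2 hEF)
        (by rw [Finset.mem_map_equiv]; simpa using hiF) (fun f hf => by
          rw [Finset.mem_map_equiv, Equiv.symm_swap] at hf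
          have h := hF _ hf
          by_cases hfx : f = x
          · exact hfx.ge
          · by_cases hfi : f = i
            · rw [hfi, Equiv.swap_apply_left] at hf; exact (hxF hf).elim
            · rw [Equiv.swap_apply_of_ne_of_ne hfi hfx] at h
              exact hnext f (lt_of_le_of_ne h (Ne.symm hfi)))
      rw [Finset.card_map] at h1 h4
      refine ⟨2 + N, E', by omega, hs.trans h2, h3, h4, fun j hj => ?_⟩
      rw [h5 j (hj.trans hix), Finset.mem_map_equiv, Equiv.symm_swap,
        Equiv.swap_apply_of_ne_of_ne hj.ne (hj.trans hix).ne]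

/-- An idle qubit is moved to the beginning of the line. -/
theorem exists_reduces_idle {d y : Fin k} (hd : (d : ℕ) = 0) (l : ℕ) (j : Fin k) (hj : (j : ℕ) = l)
    (hjy : j < y) (E : Finset (Fin k)) (hjE : j ∉ E) (hyE : y ∉ E) :
    ∃ E' : Finset (Fin k), Reduces (2 * l) E {y} E' {y} ∧ d ∉ E' ∧ y ∉ E' ∧ E'.card = E.card := by
  induction l generalizing j E with
  | zero =>
    have : j = d := Fin.ext (by omega)
    subst this
    exact ⟨E, Reduces.refl _ _, hjE, hyE, rfl⟩
  | succ l ih =>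
    obtain ⟨x, hx⟩ : ∃ x : Fin k, (x : ℕ) + 1 = j := ⟨⟨l, by omega⟩, by simp [hj]⟩
    have hxj : x < j := by rw [Fin.lt_def]; omega
    have hxy := hxj.trans hjy
    have hs := Reduces.swap (E := E) (F := {y}) (Or.inr hx) hjE
      (by simpa using hxy.ne)
    have hy : Equiv.swap j x y = y := Equiv.swap_apply_of_ne_of_ne hjy.ne' hxy.ne'
    obtain ⟨E', h1, h2, h3, h4⟩ := ih x (by omega) hxy (E.map (Equiv.swap j x).toEmbedding)
      (by rw [Finset.mem_map_equiv]; simpa using hjE)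
      (by rw [Finset.mem_map_equiv, Equiv.symm_swap, hy]; exact hyE)
    refine ⟨E', ?_, h2, h3, by rw [h4, Finset.card_map]⟩
    rw [Finset.map_singleton, Equiv.coe_toEmbedding, hy] at hs
    rw [show 2 * (l + 1) = 2 + 2 * l by ring]
    exact hs.trans h1

/-- The targets are merged into the last qubit `y` and an idle qubit is brought to the front: a
ladder between the two leftmost targets frees the first one, which then moves left, while the others
merge on the way to `y`. -/
theorem exists_reduces {E F : Finset (Fin k)} {d y : Fin k} (hd : (d : ℕ) = 0)
    (hy : (y : ℕ) + 1 = k) (hEF : Disjoint E F) (hF : 2 ≤ F.card) :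
    ∃ (N : ℕ) (E' : Finset (Fin k)), N + F.card + 1 = 2 * k ∧ Reduces N E F E' {y} ∧ d ∉ E' ∧
      y ∉ E' ∧ E'.card = E.card := by
  have hne : F.Nonempty := Finset.card_pos.1 (by omega)
  obtain ⟨a, haF, ha⟩ : ∃ a ∈ F, ∀ f ∈ F, a ≤ f :=
    ⟨F.min' hne, F.min'_mem hne, fun f hf => F.min'_le f hf⟩
  have hcard := Finset.card_erase_add_one haF
  have hne' : (F.erase a).Nonempty := Finset.card_pos.1 (by omega)
  obtain ⟨b, hbF, hb⟩ : ∃ b ∈ F.erase a, ∀ f ∈ F.erase a, b ≤ f :=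
    ⟨_, Finset.min'_mem _ hne', fun f hf => Finset.min'_le _ f hf⟩
  have hbF' := Finset.mem_of_mem_erase hbF
  have hab : a < b := lt_of_le_of_ne (ha b hbF') (Finset.ne_of_mem_erase hbF).symm
  have hby : b ≤ y := by rw [Fin.le_def]; omega
  have hab' := Fin.lt_def.1 hab
  have hby' := Fin.le_def.1 hby
  have h1 := Reduces.erase hEF haF hbF' hab
    (fun f hf haf => hb f (Finset.mem_erase.2 ⟨haf.ne', hf⟩)) (b - a - 1) (by omega)
  obtain ⟨N, E', hN, h2, hyE', hc, hE'⟩ := exists_reduces_pass hy (y - b) b (by omega) E (F.erase a)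
    (Finset.disjoint_of_subset_right (Finset.erase_subset _ _) hEF) hbF hb
  have haE' : a ∉ E' := fun h => Finset.disjoint_right.1 hEF haF ((hE' a hab).1 h)
  obtain ⟨E'', h3, hdE, hyE, hc'⟩ := exists_reduces_idle hd a a rfl (hab.trans_le hby) E' haE' hyE'
  exact ⟨_, E'', by omega, (h1.trans h2).trans h3, hdE, hyE, hc'.trans hc⟩

/-! ### The multi-target gate as a single controlled flip -/

theorem cGate_mul_cGate {C S : Finset (Fin k)} {a : Fin k} (haS : a ∉ S) (hCS : Disjoint C S) :
    cGate C {a} * cGate C S = cGate C (insert a S) := by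
  rw [cGate, cGate, permOp_mul_permOp, cGate]
  congr 1
  ext w j
  have hcond : (∀ e ∈ C, cflip C S w e = 1) ↔ ∀ e ∈ C, w e = 1 := by
    refine forall₂_congr fun e he => ?_
    simp [cflip, Finset.disjoint_left.1 hCS he]
  simp only [Function.comp]
  by_cases hc : ∀ e ∈ C, w e = 1
  · rw [cflip_of_pos (hcond.2 hc), cflip_of_pos hc, cflip_of_pos hc]
    by_cases hj : j = a
    · subst hj; simp [haS]
    · simp [hj]
  · rw [cflip_of_neg (mt hcond.1 hc), cflip_of_neg hc, cflip_of_neg hc]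

theorem list_prod_cGate {C : Finset (Fin k)} (L : List (Fin k)) (hL : L.Nodup)
    (hC : ∀ a ∈ L, a ∉ C) : (L.map fun a => cGate C {a}).prod = cGate C L.toFinset := by
  induction L with
  | nil =>
    rw [List.map_nil, List.prod_nil, cGate, ← monoOp_id]
    congr 1
  | cons a L ih =>
    rw [List.forall_mem_cons] at hC
    rw [List.nodup_cons] at hL
    rw [List.map_cons, List.prod_cons, ih hL.2 hC.2, List.toFinset_cons, cGate_mul_cGate]
    · simpa using hL.1
    · rw [Finset.disjoint_right]
      exact fun b hb => hC.2 b (by simpa using hb)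

theorem mcmtX_eq_cGate {n m : ℕ} (c : Fin n ↪ Fin k) (t : Fin m ↪ Fin k)
    (hct : ∀ i j, c i ≠ t j) :
    mcmtX c t = cGate (Finset.univ.map c) (Finset.univ.map t) := by
  have h : mcmtX c t =
      ((List.ofFn t).map fun a => cGate (Finset.univ.map c) {a}).prod := by
    rw [mcmtX, List.map_ofFn]
    simp only [controlled_pauliX]
    rfl
  rw [h, list_prod_cGate]
  · congr 1
    ext; simp [List.mem_ofFn]
  · exact List.nodup_ofFn.2 t.injective
  · intro a ha h
    obtain ⟨j, rfl⟩ := List.mem_ofFn.1 ha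
    obtain ⟨i, -, hi⟩ := Finset.mem_map.1 h
    exact hct i j hi

end LNN

end

theorem mainTheorem12 (n m k : ℕ) (hn : 5 ≤ n) (hm : 2 ≤ m) (hk : n + m ≤ k)
    (c : Fin n ↪ Fin k) (t : Fin m ↪ Fin k) (hct : ∀ i j, c i ≠ t j) :
    ∃ A : LNN.Circuit k,
      A.IsValid ∧ A.IsLNN ∧ A.op = LNN.mcmtX c t ∧
      (A.cost LNN.GateType.cnot : ℤ) ≤ 12 * k + 14 * n - 2 * m - 34 ∧
      (A.depth LNN.GateType.cnot : ℤ) ≤ 12 * k + 5 * n - 2 * m + 1 ∧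
      (A.cost LNN.GateType.t : ℤ) ≤ 16 * n - 16 ∧
      (A.depth LNN.GateType.t : ℤ) ≤ 4 * n + 4 ∧
      (A.cost LNN.GateType.h : ℤ) ≤ 8 * n + 2 * m + 2 ∧
      (A.depth LNN.GateType.h : ℤ) ≤ 4 * n + 2 * m + 1 := by
  have hcE : (Finset.univ.map c).card = n := by simp
  have hcF : (Finset.univ.map t).card = m := by simp
  have hEF : Disjoint (Finset.univ.map c) (Finset.univ.map t) := by
    rw [Finset.disjoint_left]
    intro a ha hb
    obtain ⟨i, -, rfl⟩ := Finset.mem_map.1 ha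
    obtain ⟨j, -, hj⟩ := Finset.mem_map.1 hb
    exact hct i j hj.symm
  obtain ⟨d, hd⟩ : ∃ d : Fin k, (d : ℕ) = 0 := ⟨⟨0, by omega⟩, rfl⟩
  obtain ⟨y, hy⟩ : ∃ y : Fin k, (y : ℕ) + 1 = k := ⟨⟨k - 1, by omega⟩, by simp; omega⟩
  obtain ⟨N, E', hN, ⟨M, ⟨ts, hM, hc1, ht1, hh1⟩, hMc⟩, hdE, hyE, hcE'⟩ :=
    LNN.exists_reduces hd hy hEF (hcF.symm ▸ hm)
  rw [hcE] at hcE'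
  rw [hcF] at hN
  obtain ⟨ts', hG, hc2, ht2, hh2⟩ := LNN.realizes_cGate_last hd hy hdE hyE
    (Finset.card_pos.1 (by omega))
  have hU : M.conjTranspose * M = 1 := mul_eq_one_comm.1 hM.unitary
  have hfin := hM.conj hG
  have e : M.conjTranspose * LNN.cGate E' {y} * M = LNN.mcmtX c t := by
    rw [LNN.mcmtX_eq_cGate c t hct, mul_assoc, ← hMc, ← mul_assoc, hU, one_mul]
  rw [e, hcE'] at hfin
  rw [hcE'] at hc2 ht2 hh2
  obtain ⟨A, h1, h2, h3, -, h5, h6, h7, h8⟩ := hfin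
  have dc := h3.depth_le .cnot
  have dt := h3.depth_le .t
  have dh := h3.depth_le .h
  simp only [List.count_append, List.count_reverse] at dc dt dh
  refine ⟨A, h1, h2, h5, ?_, ?_, ?_, ?_, ?_, ?_⟩ <;> omega
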